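/- Let $L>0$, let $0<\alpha<\beta$, let $a\in L^\infty(0,L)$ with $\alpha\le a(x)\le\beta$ for a.e. $x\in(0,L)$, let $g\in L^2(0,L)$, and let $\phi:\mathbb{R}\to\mathbb{R}\cup\{+\infty\}$ be continuous with values in $\mathbb{R}\cup\{+\infty\}$, with $\phi(s)<+\infty$ for every $s\neq 0$. Let $H^1_0(0,L)$ be equipped with the norm $\|z\|_{H^1_0(0,L)}=\|dz/dx\|_{L^2(0,L)}$; its elements are identified with their continuous representatives on $[0,L]$. A weak solution of $$-\frac{d}{dx}\Big(a(x)\frac{du}{dx}\Big)=-\frac{d\phi(u)}{dx}-\frac{dg}{dx}\ \text{ in }(0,L),\qquad u(0)=u(L)=0,\tag{S}$$ is a function $u\in H^1_0(0,L)$ such that $\phi(u)\in L^2(0,L)$ and the equation holds in $\mathcal{D}'(0,L)$. Assume moreover that 1. $\phi(0)=+\infty$; 2. for every $\delta\in(0,1)$, $\int_0^{\delta}\phi(t)\,dt<+\infty$ and $\int_{-\delta}^0\phi(t)\,dt<+\infty$; 3. for every $\delta>0$, $\phi$ is bounded on $\mathbb{R}\setminus(-\delta,\delta)$; 4. $\phi(s)\ge\phi(t)$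 whenever $0\le s\le t$; 5. for every $\eta\in(0,L)$ there is $M_\eta>0$ such that $g(x)\ge -M_\eta$ for a.e. $x\in[0,L-\eta]$. Suppose that (S) has at least one weak solution. Then (S) has infinitely many weak solutions. More precisely, there exist a real number $c^*$ with $$c^*\le\frac{1}{\sqrt L}\Big(\frac{\beta}{\alpha}+1\Big)\|g\|_{L^2(0,L)}-\inf_{s\in\mathbb{R}}\phi(s)$$ and a map $U:(-\infty,c^*]\to H^1_0(0,L)$, continuous for the weak topology of $H^1_0(0,L)$, such that: - for every $c\in(-\infty,c^*]$, $U(c)$ is a weak solution of (S), it satisfies $a\,\frac{dU(c)}{dx}=\phi(U(c))+g+c$ a.e. in $(0,L)$, and $U(c)\ge 0$ on $[0,L]$; - if $c_1<c_2\le c^*$, then $U(c_1)(x)<U(c_2)(x)$ for every $x\in(0,L)$; - $U(c)\to 0$ weakly in $H^1_0(0,L)$ and uniformly on $[0,L]$ as $c\to-\infty$; - every weak solution $u$ of (S) is equal to $U(c)$ for some $c\in(-\infty,c^*]$. -/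

import Mathlib

open MeasureTheory Set Filter Topology
open scoped ContDiff ENNReal

/-- Test functions on the open interval `(0, L)`: smooth functions with compact support in it. -/
structure IsTestFunction (L : ℝ) (ψ : ℝ → ℝ) : Prop where
  contDiff : ContDiff ℝ ∞ ψ
  hasCompactSupport : HasCompactSupport ψ
  tsupport_subset : tsupport ψ ⊆ Ioo 0 L

/-- The Lebesgue measure on the interval `(0, L)`. -/
noncomputable abbrev intervalMeasure (L : ℝ) : Measure ℝ := volume.restrict (Ioo 0 L)

/-- `w` is the distributional derivative of `u` on `(0, L)`. -/
def HasWeakDeriv (L : ℝ) (u w : ℝ → ℝ) : Prop :=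
  ∀ ψ : ℝ → ℝ, IsTestFunction L ψ →
    ∫ x in Ioo 0 L, u x * deriv ψ x = - ∫ x in Ioo 0 L, w x * ψ x

theorem integrable_mul_of_hasCompactSupport {L : ℝ} {u ψ : ℝ → ℝ} (hu : Continuous u)
    (hψ : Continuous ψ) (hc : HasCompactSupport ψ) :
    Integrable (fun x => u x * ψ x) (intervalMeasure L) :=
  ((hu.mul hψ).integrable_of_hasCompactSupport hc.mul_left).integrableOn

theorem IsTestFunction.continuous_deriv {L : ℝ} {ψ : ℝ → ℝ} (h : IsTestFunction L ψ) :
    Continuous (deriv ψ) :=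
  h.contDiff.continuous_deriv (by simp)

theorem IsTestFunction.integrable_Lp_mul {L : ℝ} {ψ : ℝ → ℝ} (h : IsTestFunction L ψ)
    (w : Lp ℝ 2 (intervalMeasure L)) :
    Integrable (fun x => w x * ψ x) (intervalMeasure L) :=
  (Lp.memLp w).integrable_mul (p := 2) (q := 2)
    ((h.contDiff.continuous.memLp_of_hasCompactSupport h.hasCompactSupport).restrict _)

/-- The vector space underlying `H^1_0(0, L)`. An element is a pair consisting of the continuous
representative `u` of a function of `H^1(0, L)` with `u(0) = u(L) = 0`, extended by zero outside
`(0, L)`, and of its distributional derivative, a class in `L^2(0, L)`, which is determined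
by `u`. -/
noncomputable def sobolevZeroSubmodule (L : ℝ) :
    Submodule ℝ (C(ℝ, ℝ) × Lp ℝ 2 (intervalMeasure L)) where
  carrier := {p | (∀ x ∉ Ioo 0 L, p.1 x = 0) ∧ HasWeakDeriv L p.1 p.2}
  zero_mem' := by
    refine ⟨fun x _ => rfl, fun ψ hψ => ?_⟩
    have : ∫ x in Ioo 0 L, (0 : Lp ℝ 2 (intervalMeasure L)) x * ψ x = 0 := by
      refine integral_eq_zero_of_ae ?_
      filter_upwards [Lp.coeFn_zero ℝ 2 (intervalMeasure L)] with x hx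
      rw [hx]
      simp
    simp only [Prod.fst_zero, ContinuousMap.zero_apply, zero_mul, integral_zero, Prod.snd_zero]
    rw [this, neg_zero]
  add_mem' := by
    rintro p q ⟨hp, hp'⟩ ⟨hq, hq'⟩
    refine ⟨fun x hx => by simp [hp x hx, hq x hx], fun ψ hψ => ?_⟩
    have h1 : ∫ x in Ioo 0 L, (p.2 + q.2 : Lp ℝ 2 (intervalMeasure L)) x * ψ x
        = ∫ x in Ioo 0 L, (p.2 x * ψ x + q.2 x * ψ x) := by
      refine integral_congr_ae ?_
      filter_upwards [Lp.coeFn_add p.2 q.2] with x hx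
      rw [hx, Pi.add_apply, add_mul]
    have hc := hψ.hasCompactSupport.deriv
    simp only [Prod.fst_add, ContinuousMap.add_apply, Prod.snd_add, add_mul]
    rw [h1, integral_add (integrable_mul_of_hasCompactSupport p.1.continuous hψ.continuous_deriv hc)
      (integrable_mul_of_hasCompactSupport q.1.continuous hψ.continuous_deriv hc),
      integral_add (hψ.integrable_Lp_mul p.2) (hψ.integrable_Lp_mul q.2), hp' ψ hψ, hq' ψ hψ]
    ring
  smul_mem' := by
    rintro c p ⟨hp, hp'⟩
    refine ⟨fun x hx => by simp [hp x hx], fun ψ hψ => ?_⟩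
    have h1 : ∫ x in Ioo 0 L, (c • p.2 : Lp ℝ 2 (intervalMeasure L)) x * ψ x
        = ∫ x in Ioo 0 L, c * (p.2 x * ψ x) := by
      refine integral_congr_ae ?_
      filter_upwards [Lp.coeFn_smul c p.2] with x hx
      simp [hx, mul_assoc]
    simp only [Prod.smul_fst, ContinuousMap.smul_apply, Prod.smul_snd, smul_eq_mul, mul_assoc]
    rw [h1, integral_const_mul, integral_const_mul, hp' ψ hψ]
    ring

/-- A continuous function vanishing outside `(0, L)` with zero distributional derivative on
`(0, L)` is zero. -/
theorem eq_zero_of_hasWeakDeriv_zero {L : ℝ} {u : ℝ → ℝ} (hu : Continuous u)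
    (h0 : ∀ x ∉ Ioo 0 L, u x = 0)
    (h : ∀ ψ : ℝ → ℝ, IsTestFunction L ψ → ∫ x in Ioo 0 L, u x * deriv ψ x = 0) :
    ∀ x, u x = 0 := by
  rcases le_or_gt L 0 with hL | hL
  · intro x
    exact h0 x (by simp [Ioo_eq_empty (not_lt.mpr hL)])
  let B : ContDiffBump (L / 2) := ⟨L / 8, L / 4, by positivity, by linarith⟩
  set η : ℝ → ℝ := B.normed volume with hη
  have hηs : ContDiff ℝ ∞ η := B.contDiff_normed
  have hηc : HasCompactSupport η := B.hasCompactSupport_normed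
  have hηt : tsupport η ⊆ Ioo 0 L := by
    rw [hη, B.tsupport_normed_eq, Real.closedBall_eq_Icc]
    intro x hx
    have h1 : B.rOut = L / 4 := rfl
    rw [h1] at hx
    exact ⟨by linarith [hx.1], by linarith [hx.2]⟩
  have hηi : ∫ x, η x = 1 := B.integral_normed
  set k : ℝ := ∫ x in Ioo 0 L, u x * η x with hk
  have key : ∀ f : ℝ → ℝ, ContDiff ℝ ∞ f → HasCompactSupport f → tsupport f ⊆ Ioo 0 L →
      ∫ x, f x • (u x - k) = 0 := by
    intro f hf hfc hft
    set I : ℝ := ∫ x, f x with hI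
    set F : ℝ → ℝ := fun x => f x - I * η x with hF
    have hFs : ContDiff ℝ ∞ F := hf.sub (contDiff_const.mul hηs)
    have hfi : Integrable f := hf.continuous.integrable_of_hasCompactSupport hfc
    have hηint : Integrable η := hηs.continuous.integrable_of_hasCompactSupport hηc
    have hFint : Integrable F := hfi.sub (hηint.const_mul I)
    have hF0 : ∫ x, F x = 0 := by
      rw [hF, integral_sub hfi (hηint.const_mul I), integral_const_mul, hηi]
      simp [hI]
    obtain ⟨a, b, ha, hb, hab⟩ : ∃ a b : ℝ, 0 < a ∧ b < L ∧ ∀ x ∉ Icc a b, F x = 0 := by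
      have hK : IsCompact (tsupport f ∪ tsupport η) := hfc.isCompact.union hηc.isCompact
      have hne : (tsupport f ∪ tsupport η).Nonempty := by
        refine Nonempty.inr ?_
        by_contra hemp
        have hz : η = 0 := tsupport_eq_empty_iff.mp (not_nonempty_iff_eq_empty.mp hemp)
        rw [hz] at hηi
        simp at hηi
      have hsub : tsupport f ∪ tsupport η ⊆ Ioo 0 L := union_subset hft hηt
      obtain ⟨a, haK, ha⟩ := hK.exists_isLeast hne
      obtain ⟨b, hbK, hb⟩ := hK.exists_isGreatest hne
      refine ⟨a, b, (hsub haK).1, (hsub hbK).2, fun x hx => ?_⟩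
      have hxK : x ∉ tsupport f ∪ tsupport η := fun hxK => hx ⟨ha hxK, hb hxK⟩
      rw [mem_union, not_or] at hxK
      simp [hF, image_eq_zero_of_notMem_tsupport hxK.1, image_eq_zero_of_notMem_tsupport hxK.2]
    set ψ : ℝ → ℝ := fun x => ∫ t in (0 : ℝ)..x, F t with hψ
    have hderiv : ∀ x, HasDerivAt ψ (F x) x := fun x =>
      intervalIntegral.integral_hasDerivAt_right (hFint.intervalIntegrable)
        (hFs.continuous.stronglyMeasurableAtFilter _ _) hFs.continuous.continuousAt
    have hderiv' : deriv ψ = F := funext fun x => (hderiv x).deriv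
    have hψ0 : ∀ x ∉ Icc a b, ψ x = 0 := by
      intro x hx
      rw [mem_Icc, not_and_or, not_le, not_le] at hx
      rcases hx with hx | hx
      · refine intervalIntegral.integral_zero_ae (Eventually.of_forall fun t ht => ?_)
        refine hab t fun h' => ?_
        rcases mem_uIoc.mp ht with h2 | h2
        · linarith [h2.2, h'.1]
        · linarith [h2.2, h'.1]
      · by_cases hx0 : x ≤ 0
        · refine intervalIntegral.integral_zero_ae (Eventually.of_forall fun t ht => ?_)
          refine hab t fun h' => ?_
          rcases mem_uIoc.mp ht with h2 | h2
          · linarith [h2.2, h'.1, h2.1]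
          · linarith [h2.2, h'.1]
        · rw [hψ]
          simp only
          rw [intervalIntegral.integral_of_le (not_le.mp hx0).le,
            setIntegral_eq_integral_of_forall_compl_eq_zero, hF0]
          intro t ht
          refine hab t fun h' => ht ⟨by linarith [h'.1], by linarith [h'.2]⟩
    have hsupp : tsupport ψ ⊆ Icc a b := by
      refine closure_minimal (fun x hx => ?_) isClosed_Icc
      by_contra hx'
      exact hx (hψ0 x hx')
    have htest : IsTestFunction L ψ := by
      refine ⟨?_, ?_, hsupp.trans fun x hx => ⟨by linarith [hx.1], by linarith [hx.2]⟩⟩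
      · rw [contDiff_infty_iff_deriv, hderiv']
        exact ⟨fun x => (hderiv x).differentiableAt, hFs⟩
      · exact HasCompactSupport.of_support_subset_isCompact isCompact_Icc
          (subset_closure.trans hsupp)
    have h1 := h ψ htest
    rw [hderiv'] at h1
    have h2 : ∫ x in Ioo 0 L, u x * F x = (∫ x in Ioo 0 L, u x * f x) - I * k := by
      rw [hk, ← integral_const_mul, ← integral_sub
        (integrable_mul_of_hasCompactSupport hu hf.continuous hfc)
        ((integrable_mul_of_hasCompactSupport hu hηs.continuous hηc).const_mul I)]
      refine integral_congr_ae (Eventually.of_forall fun x => ?_)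
      simp only [hF]
      ring
    have h3 : ∫ x in Ioo 0 L, u x * f x = ∫ x, u x * f x := by
      refine setIntegral_eq_integral_of_forall_compl_eq_zero fun x hx => ?_
      rw [h0 x hx, zero_mul]
    have h4 : Integrable (fun x => u x * f x) :=
      (hu.mul hf.continuous).integrable_of_hasCompactSupport hfc.mul_left
    have h5 : ∫ x, f x • (u x - k) = (∫ x, u x * f x) - I * k := by
      rw [hI, ← integral_mul_const, ← integral_sub h4 (hfi.mul_const k)]
      refine integral_congr_ae (Eventually.of_forall fun x => ?_)
      simp only [smul_eq_mul]
      ring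
    rw [h5, ← h3, ← h2, h1]
  have hae : ∀ᵐ x : ℝ, x ∈ Ioo 0 L → u x - k = 0 :=
    isOpen_Ioo.ae_eq_zero_of_integral_contDiff_smul_eq_zero
      ((hu.sub continuous_const).locallyIntegrable.locallyIntegrableOn _) key
  have heq : EqOn u (fun _ => k) (Ioo 0 L) := by
    refine Measure.eqOn_open_of_ae_eq (μ := volume) ?_ isOpen_Ioo hu.continuousOn
      continuous_const.continuousOn
    rw [EventuallyEq, ae_restrict_iff' measurableSet_Ioo]
    filter_upwards [hae] with x hx hx'
    linarith [hx hx']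
  have hcl : EqOn u (fun _ => k) (closure (Ioo 0 L)) := heq.closure hu continuous_const
  rw [closure_Ioo hL.ne] at hcl
  have hk0 : k = 0 := by
    have h1 := hcl (left_mem_Icc.mpr hL.le)
    rw [h0 0 (by simp)] at h1
    exact h1.symm
  intro x
  by_cases hx : x ∈ Ioo 0 L
  · rw [heq hx, hk0]
  · exact h0 x hx

/-- The Sobolev space `H^1_0(0, L)`. -/
def SobolevZero (L : ℝ) : Type := ↥(sobolevZeroSubmodule L)

namespace SobolevZero

variable {L : ℝ}

noncomputable instance : AddCommGroup (SobolevZero L) :=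
  inferInstanceAs (AddCommGroup ↥(sobolevZeroSubmodule L))

noncomputable instance : Module ℝ (SobolevZero L) :=
  inferInstanceAs (Module ℝ ↥(sobolevZeroSubmodule L))

/-- The continuous representative, extended by zero outside `(0, L)`. -/
instance : CoeFun (SobolevZero L) (fun _ => ℝ → ℝ) := ⟨fun u => u.1.1⟩

/-- The distributional derivative `du/dx`, as a linear map to `L^2(0, L)`. -/
noncomputable def weakDeriv : SobolevZero L →ₗ[ℝ] Lp ℝ 2 (intervalMeasure L) :=
  (LinearMap.snd ℝ C(ℝ, ℝ) (Lp ℝ 2 (intervalMeasure L))).comp (sobolevZeroSubmodule L).subtype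

theorem weakDeriv_injective : Function.Injective (weakDeriv (L := L)) := by
  refine (injective_iff_map_eq_zero _).mpr fun u hu => ?_
  have hu2 : u.1.2 = 0 := hu
  have h1 : ∀ x, u x = 0 := by
    refine eq_zero_of_hasWeakDeriv_zero u.1.1.continuous u.2.1 fun ψ hψ => ?_
    rw [u.2.2 ψ hψ, hu2, neg_eq_zero]
    refine integral_eq_zero_of_ae ?_
    filter_upwards [Lp.coeFn_zero ℝ 2 (intervalMeasure L)] with x hx
    rw [hx]
    simp
  exact Subtype.ext (Prod.ext (ContinuousMap.ext h1) hu2)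

/-- The norm of `H^1_0(0, L)` is `‖u‖ = ‖du/dx‖` in `L^2(0, L)`. -/
noncomputable instance : NormedAddCommGroup (SobolevZero L) :=
  NormedAddCommGroup.induced _ _ weakDeriv weakDeriv_injective

noncomputable instance : NormedSpace ℝ (SobolevZero L) :=
  NormedSpace.induced ℝ _ _ weakDeriv

end SobolevZero

/-- `u` is a weak solution of
`-(a u')' = -(φ(u))' - g'` in `(0, L)`, `u(0) = u(L) = 0`:
`u ∈ H^1_0(0, L)`, `φ(u) ∈ L^2(0, L)` (in particular `φ(u)` is finite almost everywhere), and the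
equation holds in the sense of distributions on `(0, L)`. -/
structure IsWeakSolution (L : ℝ) (a g : ℝ → ℝ) (φ : ℝ → EReal) (u : SobolevZero L) : Prop where
  finite_ae : ∀ᵐ x ∂(intervalMeasure L), φ (u x) ≠ ⊤ ∧ φ (u x) ≠ ⊥
  memLp : MemLp (fun x => (φ (u x)).toReal) 2 (intervalMeasure L)
  equation : ∀ ψ : ℝ → ℝ, IsTestFunction L ψ →
    ∫ x in Ioo 0 L, a x * u.weakDeriv x * deriv ψ x =
      (∫ x in Ioo 0 L, (φ (u x)).toReal * deriv ψ x) + ∫ x in Ioo 0 L, g x * deriv ψ x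

/-! Integrating once (du Bois-Reymond), `u` is a weak solution exactly when `a u' = φ(u) + g + c`
a.e. for some constant `c`, with `φ(u)` in `L^2`. At a zero of `u` the term `φ(u)` is infinite,
while `g` is bounded below away from `L`. So `u' ≥ 1/β` near every zero `p < L`, and `u` can be
neither negative nor zero inside `(0, L)`. Only `f`, the restriction of `φ` to `(0, ∞)`, matters,
and weak solutions are the "profiles" of `IsProfile`.

Since `f` is non-increasing, profiles can be compared: where `v₂ < v₁` and `c₁ ≤ c₂`, the difference
`v₂ - v₁` has nonnegative slope, so it never becomes negative (`primitive_nonneg`,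
`IsProfile.le_of_le`). This gives uniqueness for each `c`, monotonicity in `c`, and a Lipschitz
bound in `c` (`IsProfile.sub_le`). Because `∫ f(v) v' = 0` for a function vanishing at both ends,
`‖v'‖ ≤ ‖g‖ / α` whatever `c` is (`IsProfile.integral_slopeField_sq_le`), and averaging the equation
bounds `c` from above (`IsProfile.const_le`).

The admissible constants form a closed half-line. It is downward closed
(`IsAdmissible.exists_profile_of_le`): for `c ≤ c₀`, `f` is replaced by Lipschitz functions
increasing to it. The resulting solutions increase, stay below the profile for `c₀`, and lie above a
line `κ x` that controls the singularity at `0`; the profile above forces the limit to vanish at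
`L`. It contains its supremum (`IsAdmissible.exists_profile_of_tendsto`) by an increasing limit.

As `c → -∞`, a profile above `δ / 2` is driven down too strongly to reach `δ`
(`IsProfile.exists_forall_lt`). Uniform smallness and the energy bound then give weak convergence to
zero. -/

/-! ### Absolutely continuous functions -/

/-- Composition of an absolutely continuous function with a function which is Lipschitz on its
range is absolutely continuous. -/
theorem AbsolutelyContinuousOnInterval.lipschitzOnWith_comp {u Φ : ℝ → ℝ} {a b : ℝ} {K : NNReal}
    {s : Set ℝ} (hΦ : LipschitzOnWith K Φ s) (hu : AbsolutelyContinuousOnInterval u a b)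
    (hs : MapsTo u (uIcc a b) s) :
    AbsolutelyContinuousOnInterval (fun x => Φ (u x)) a b := by
  rw [absolutelyContinuousOnInterval_iff] at hu ⊢
  intro ε hε
  obtain ⟨δ, hδ, h⟩ := hu (ε / (K + 1)) (by positivity)
  refine ⟨δ, hδ, fun E hE hlt => ?_⟩
  have h1 := h E hE hlt
  calc ∑ i ∈ Finset.range E.1, dist (Φ (u (E.2 i).1)) (Φ (u (E.2 i).2))
      ≤ ∑ i ∈ Finset.range E.1, K * dist (u (E.2 i).1) (u (E.2 i).2) := by
        refine Finset.sum_le_sum fun i hi => ?_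
        have := hE.1 i hi
        exact hΦ.dist_le_mul _ (hs this.1) _ (hs this.2)
    _ = K * ∑ i ∈ Finset.range E.1, dist (u (E.2 i).1) (u (E.2 i).2) := by
        rw [Finset.mul_sum]
    _ ≤ K * (ε / (K + 1)) := by gcongr
    _ < (K + 1) * (ε / (K + 1)) := by
        have : (0 : ℝ) < ε / (K + 1) := by positivity
        nlinarith
    _ = ε := by field_simp

/-- Change of variables for a primitive `u` of an integrable function `w`. -/
theorem integral_comp_mul_of_primitive {F w u : ℝ → ℝ} {p q : ℝ} (hF : Continuous F)
    (hw : IntervalIntegrable w volume p q)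
    (hu : ∀ x ∈ uIcc p q, u x = u p + ∫ t in p..x, w t) :
    ∫ t in p..q, F (u t) * w t = ∫ s in (u p)..(u q), F s := by
  set v : ℝ → ℝ := fun x => u p + ∫ t in p..x, w t with hv
  have hvp : v p = u p := by simp [hv]
  have hvq : v q = u q := (hu q right_mem_uIcc).symm
  have hvac : AbsolutelyContinuousOnInterval v p q := by
    have h1 : AbsolutelyContinuousOnInterval (fun _ : ℝ => u p) p q :=
      (contDiff_const (n := 1)).contDiffOn.absolutelyContinuousOnInterval
    exact h1.add (hw.absolutelyContinuousOnInterval_intervalIntegral left_mem_uIcc)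
  obtain ⟨B, hB⟩ := hvac.exists_bound
  obtain ⟨C, hC⟩ := (isCompact_Icc (a := -B) (b := B)).exists_bound_of_continuousOn hF.continuousOn
  -- `Φ` is Lipschitz on the bounded range of `v`, so `Φ ∘ v` is absolutely continuous. The
  -- fundamental theorem then applies although the chain rule holds only almost everywhere.
  set Φ : ℝ → ℝ := fun s => ∫ r in (u p)..s, F r with hΦ
  have hlip : LipschitzOnWith (Real.toNNReal C) Φ (Icc (-B) B) := by
    refine LipschitzOnWith.of_dist_le_mul fun x hx y hy => ?_
    have h0 : 0 ≤ C := (norm_nonneg _).trans (hC x hx)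
    rw [Real.coe_toNNReal _ h0, dist_comm, Real.dist_eq, Real.dist_eq, hΦ]
    simp only
    rw [intervalIntegral.integral_interval_sub_left (hF.intervalIntegrable _ _)
      (hF.intervalIntegrable _ _), abs_sub_comm x y, ← Real.norm_eq_abs]
    refine intervalIntegral.norm_integral_le_of_norm_le_const fun r hr => hC r ?_
    exact (uIcc_subset_Icc hx hy) (uIoc_subset_uIcc hr)
  have hmaps : MapsTo v (uIcc p q) (Icc (-B) B) := fun x hx => abs_le.mp (hB x hx)
  have hac := AbsolutelyContinuousOnInterval.lipschitzOnWith_comp hlip hvac hmaps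
  have hder : ∀ᵐ x, x ∈ uIcc p q → HasDerivAt (fun x => Φ (v x)) (F (v x) * w x) x := by
    filter_upwards [hw.ae_hasDerivAt_integral] with x hx hxI
    have h1 : HasDerivAt v (w x) x := (hx hxI p left_mem_uIcc).const_add _
    have h2 : HasDerivAt Φ (F (v x)) (v x) :=
      intervalIntegral.integral_hasDerivAt_right (hF.intervalIntegrable _ _)
        (hF.stronglyMeasurableAtFilter _ _) hF.continuousAt
    exact h2.comp x h1
  have h3 := hac.integral_deriv_eq_sub
  have h4 : ∫ t in p..q, F (u t) * w t = ∫ x in p..q, deriv (fun x => Φ (v x)) x := by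
    refine intervalIntegral.integral_congr_ae ?_
    filter_upwards [hder] with x hx hxI
    rw [(hx (uIoc_subset_uIcc hxI)).deriv, hu x (uIoc_subset_uIcc hxI)]
  rw [h4, h3, hvp, hvq]
  simp [hΦ]

/-- Integration by parts for absolutely continuous functions. The primitive vanishes at `0`, so `ψ`
only has to vanish at `L`. -/
theorem integral_primitive_mul_deriv {L : ℝ} {w ψ : ℝ → ℝ}
    (hw : IntervalIntegrable w volume 0 L) (hψ : ContDiff ℝ 1 ψ) (h0 : ψ L = 0) :
    ∫ x in (0 : ℝ)..L, (∫ t in (0 : ℝ)..x, w t) * deriv ψ x =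
      - ∫ x in (0 : ℝ)..L, w x * ψ x := by
  have hac := hw.absolutelyContinuousOnInterval_intervalIntegral (c := 0) left_mem_uIcc
  rw [hac.integral_mul_deriv_eq_deriv_mul hψ.contDiffOn.absolutelyContinuousOnInterval, h0]
  simp only [mul_zero, intervalIntegral.integral_same, zero_mul, sub_zero, zero_sub, neg_inj]
  refine intervalIntegral.integral_congr_ae ?_
  filter_upwards [hw.ae_hasDerivAt_integral] with x hx hxI
  rw [(hx (uIoc_subset_uIcc hxI) 0 left_mem_uIcc).deriv]

/-- Lebesgue differentiation: `w` is a.e. the derivative of its primitive, which is constant. -/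
theorem ae_eq_zero_of_forall_integral_eq_zero {L : ℝ} (hL : 0 ≤ L) {w : ℝ → ℝ}
    (hw : IntervalIntegrable w volume 0 L) (h : ∀ x ∈ Icc 0 L, ∫ t in (0 : ℝ)..x, w t = 0) :
    ∀ᵐ x ∂(intervalMeasure L), w x = 0 := by
  rw [ae_restrict_iff' measurableSet_Ioo]
  filter_upwards [hw.ae_hasDerivAt_integral] with x hx hxI
  have hd := hx (by rw [uIcc_of_le hL]; exact Ioo_subset_Icc_self hxI) 0 left_mem_uIcc
  refine hd.unique ((hasDerivAt_const x (0 : ℝ)).congr_of_eventuallyEq ?_)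
  filter_upwards [isOpen_Ioo.mem_nhds hxI] with y hy using h y (Ioo_subset_Icc_self hy)

/-! ### The du Bois-Reymond lemma -/

theorem IsTestFunction.integrable_mul_deriv {L : ℝ} {f ψ : ℝ → ℝ} (hψ : IsTestFunction L ψ)
    (hf : Integrable f (intervalMeasure L)) :
    Integrable (fun x => f x * deriv ψ x) (intervalMeasure L) := by
  obtain ⟨C, hC⟩ := hψ.hasCompactSupport.deriv.exists_bound_of_continuous hψ.continuous_deriv
  exact hf.mul_bdd hψ.continuous_deriv.aestronglyMeasurable (Eventually.of_forall hC)

/-- For a fixed bump `η` of mass one, `f - (∫ f) η` has mean zero and is the derivative of a test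
function. Hence `∫ u f = k ∫ f` with `k = ∫ u η`, for every test function `f`. -/
theorem exists_ae_eq_const_of_integral_mul_deriv_eq_zero {L : ℝ} (hL : 0 < L) {u : ℝ → ℝ}
    (hu : Integrable u (intervalMeasure L))
    (h : ∀ ψ : ℝ → ℝ, IsTestFunction L ψ → ∫ x in Ioo 0 L, u x * deriv ψ x = 0) :
    ∃ k : ℝ, ∀ᵐ x ∂(intervalMeasure L), u x = k := by
  let B : ContDiffBump (L / 2) := ⟨L / 8, L / 4, by positivity, by linarith⟩
  set η : ℝ → ℝ := B.normed volume with hη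
  have hηs : ContDiff ℝ ∞ η := B.contDiff_normed
  have hηc : HasCompactSupport η := B.hasCompactSupport_normed
  have hηt : tsupport η ⊆ Ioo 0 L := by
    rw [hη, B.tsupport_normed_eq, Real.closedBall_eq_Icc]
    intro x hx
    have h1 : B.rOut = L / 4 := rfl
    rw [h1] at hx
    exact ⟨by linarith [hx.1], by linarith [hx.2]⟩
  have hηi : ∫ x, η x = 1 := B.integral_normed
  have hum : ∀ f : ℝ → ℝ, Continuous f → HasCompactSupport f →
      Integrable (fun x => u x * f x) (intervalMeasure L) := by
    intro f hf hfc
    obtain ⟨C, hC⟩ := hfc.exists_bound_of_continuous hf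
    exact hu.mul_bdd hf.aestronglyMeasurable (Eventually.of_forall hC)
  set k : ℝ := ∫ x in Ioo 0 L, u x * η x with hk
  have key : ∀ f : ℝ → ℝ, ContDiff ℝ ∞ f → HasCompactSupport f → tsupport f ⊆ Ioo 0 L →
      ∫ x, f x • (u x - k) = 0 := by
    intro f hf hfc hft
    set I : ℝ := ∫ x, f x with hI
    set F : ℝ → ℝ := fun x => f x - I * η x with hF
    have hFs : ContDiff ℝ ∞ F := hf.sub (contDiff_const.mul hηs)
    have hfi : Integrable f := hf.continuous.integrable_of_hasCompactSupport hfc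
    have hηint : Integrable η := hηs.continuous.integrable_of_hasCompactSupport hηc
    have hFint : Integrable F := hfi.sub (hηint.const_mul I)
    have hF0 : ∫ x, F x = 0 := by
      rw [hF, integral_sub hfi (hηint.const_mul I), integral_const_mul, hηi]
      simp [hI]
    obtain ⟨a, b, ha, hb, hab⟩ : ∃ a b : ℝ, 0 < a ∧ b < L ∧ ∀ x ∉ Icc a b, F x = 0 := by
      have hK : IsCompact (tsupport f ∪ tsupport η) := hfc.isCompact.union hηc.isCompact
      have hne : (tsupport f ∪ tsupport η).Nonempty := by
        refine Nonempty.inr ?_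
        by_contra hemp
        have hz : η = 0 := tsupport_eq_empty_iff.mp (not_nonempty_iff_eq_empty.mp hemp)
        rw [hz] at hηi
        simp at hηi
      have hsub : tsupport f ∪ tsupport η ⊆ Ioo 0 L := union_subset hft hηt
      obtain ⟨a, haK, ha⟩ := hK.exists_isLeast hne
      obtain ⟨b, hbK, hb⟩ := hK.exists_isGreatest hne
      refine ⟨a, b, (hsub haK).1, (hsub hbK).2, fun x hx => ?_⟩
      have hxK : x ∉ tsupport f ∪ tsupport η := fun hxK => hx ⟨ha hxK, hb hxK⟩
      rw [mem_union, not_or] at hxK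
      simp [hF, image_eq_zero_of_notMem_tsupport hxK.1, image_eq_zero_of_notMem_tsupport hxK.2]
    set ψ : ℝ → ℝ := fun x => ∫ t in (0 : ℝ)..x, F t with hψ
    have hderiv : ∀ x, HasDerivAt ψ (F x) x := fun x =>
      intervalIntegral.integral_hasDerivAt_right (hFint.intervalIntegrable)
        (hFs.continuous.stronglyMeasurableAtFilter _ _) hFs.continuous.continuousAt
    have hderiv' : deriv ψ = F := funext fun x => (hderiv x).deriv
    -- To the left of `a` the integrand vanishes; to the right of `b` the primitive is the full
    -- integral of `F`, which is zero.
    have hψ0 : ∀ x ∉ Icc a b, ψ x = 0 := by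
      intro x hx
      rw [mem_Icc, not_and_or, not_le, not_le] at hx
      have hvan : ∀ y : ℝ, y < a → ∫ t in (0 : ℝ)..y, F t = 0 := by
        intro y hy
        refine intervalIntegral.integral_zero_ae (Eventually.of_forall fun t ht => ?_)
        refine hab t fun h' => ?_
        rcases mem_uIoc.mp ht with h2 | h2
        · linarith [h2.2, h'.1]
        · linarith [h2.2, h'.1]
      rcases hx with hx | hx
      · exact hvan x hx
      · by_cases hx0 : x ≤ 0
        · exact hvan x (hx0.trans_lt ha)
        · rw [hψ]
          simp only
          rw [intervalIntegral.integral_of_le (not_le.mp hx0).le,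
            setIntegral_eq_integral_of_forall_compl_eq_zero, hF0]
          intro t ht
          refine hab t fun h' => ht ⟨by linarith [h'.1], by linarith [h'.2]⟩
    have hsupp : tsupport ψ ⊆ Icc a b := by
      refine closure_minimal (fun x hx => ?_) isClosed_Icc
      by_contra hx'
      exact hx (hψ0 x hx')
    have htest : IsTestFunction L ψ := by
      refine ⟨?_, ?_, hsupp.trans fun x hx => ⟨by linarith [hx.1], by linarith [hx.2]⟩⟩
      · rw [contDiff_infty_iff_deriv, hderiv']
        exact ⟨fun x => (hderiv x).differentiableAt, hFs⟩
      · exact HasCompactSupport.of_support_subset_isCompact isCompact_Icc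
          (subset_closure.trans hsupp)
    have h1 := h ψ htest
    rw [hderiv'] at h1
    have h2 : ∫ x in Ioo 0 L, u x * F x = (∫ x in Ioo 0 L, u x * f x) - I * k := by
      rw [hk, ← integral_const_mul, ← integral_sub (hum f hf.continuous hfc)
        ((hum η hηs.continuous hηc).const_mul I)]
      refine integral_congr_ae (Eventually.of_forall fun x => ?_)
      simp only [hF]
      ring
    have hsup : ∀ x ∉ Ioo 0 L, f x = 0 := fun x hx =>
      image_eq_zero_of_notMem_tsupport fun hx' => hx (hft hx')
    have h3 : ∫ x in Ioo 0 L, f x • (u x - k) = ∫ x, f x • (u x - k) := by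
      refine setIntegral_eq_integral_of_forall_compl_eq_zero fun x hx => ?_
      rw [hsup x hx, zero_smul]
    have h3' : ∫ x in Ioo 0 L, f x = I :=
      setIntegral_eq_integral_of_forall_compl_eq_zero hsup
    have h5 : ∫ x in Ioo 0 L, f x • (u x - k) = (∫ x in Ioo 0 L, u x * f x) - I * k := by
      rw [← h3', ← integral_mul_const,
        ← integral_sub (hum f hf.continuous hfc) (hfi.integrableOn.mul_const k)]
      refine integral_congr_ae (Eventually.of_forall fun x => ?_)
      simp only [smul_eq_mul]
      ring
    rw [← h3, h5, ← h2, h1]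
  refine ⟨k, ?_⟩
  have hloc : LocallyIntegrableOn (fun x => u x - k) (Ioo 0 L) :=
    IntegrableOn.locallyIntegrableOn (Integrable.sub hu (integrable_const k))
  have hae : ∀ᵐ x : ℝ, x ∈ Ioo 0 L → u x - k = 0 :=
    isOpen_Ioo.ae_eq_zero_of_integral_contDiff_smul_eq_zero hloc key
  rw [ae_restrict_iff' measurableSet_Ioo]
  filter_upwards [hae] with x hx hx'
  linarith [hx hx']

/-! ### Sign of primitives -/

/-- The last zero of a continuous function before a point where it is negative. -/
theorem exists_last_zero {F : ℝ → ℝ} {a b : ℝ} (hab : a ≤ b) (hF : ContinuousOn F (Icc a b))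
    (ha : 0 ≤ F a) (hb : F b < 0) :
    ∃ p ∈ Ico a b, F p = 0 ∧ ∀ x ∈ Ioc p b, F x < 0 := by
  set S : Set ℝ := {x ∈ Icc a b | 0 ≤ F x} with hS
  have hSc : IsCompact S := by
    have : S = Icc a b ∩ F ⁻¹' (Ici 0) := rfl
    rw [this]
    exact isCompact_Icc.of_isClosed_subset (hF.preimage_isClosed_of_isClosed isClosed_Icc isClosed_Ici)
      inter_subset_left
  obtain ⟨p, hp, hpm⟩ := hSc.exists_isGreatest ⟨a, left_mem_Icc.mpr hab, ha⟩
  have hpb : p < b := lt_of_le_of_ne hp.1.2 fun h => by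
    have := hp.2
    rw [h] at this
    linarith
  have hneg : ∀ x ∈ Ioc p b, F x < 0 := by
    intro x hx
    by_contra hx'
    have := hpm ⟨⟨hp.1.1.trans hx.1.le, hx.2⟩, not_lt.mp hx'⟩
    linarith [hx.1]
  refine ⟨p, ⟨hp.1.1, hpb⟩, le_antisymm ?_ hp.2, hneg⟩
  have hcw : ContinuousWithinAt F (Ioc p b) p :=
    (hF p hp.1).mono fun x hx => ⟨hp.1.1.trans hx.1.le, hx.2⟩
  have : (𝓝[Ioc p b] p).NeBot := by
    rw [← mem_closure_iff_nhdsWithin_neBot, closure_Ioc hpb.ne]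
    exact left_mem_Icc.mpr hpb.le
  exact le_of_tendsto hcw (eventually_nhdsWithin_of_forall fun x hx => (hneg x hx).le)

theorem IntervalIntegrable.mono_Icc {h : ℝ → ℝ} {a b x y : ℝ}
    (hh : IntervalIntegrable h volume a b) (hx : x ∈ Icc a b) (hy : y ∈ Icc a b) :
    IntervalIntegrable h volume x y :=
  hh.mono_set (by rw [uIcc_of_le (hx.1.trans hx.2)]; exact uIcc_subset_Icc hx hy)

theorem continuousOn_primitive_Icc {h : ℝ → ℝ} {a b : ℝ} (hab : a ≤ b)
    (hh : IntervalIntegrable h volume a b) :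
    ContinuousOn (fun x => ∫ t in a..x, h t) (Icc a b) := by
  have := intervalIntegral.continuousOn_primitive_interval' hh left_mem_uIcc
  rwa [uIcc_of_le hab] at this

/-- A primitive whose derivative is nonnegative where it is negative is nonnegative. -/
theorem primitive_nonneg {F h : ℝ → ℝ} {R : ℝ}
    (hh : IntervalIntegrable h volume 0 R) (hF : ∀ x ∈ Icc 0 R, F x = ∫ t in (0 : ℝ)..x, h t)
    (hpos : ∀ᵐ x, x ∈ Ioo 0 R → F x < 0 → 0 ≤ h x) : ∀ x ∈ Icc 0 R, 0 ≤ F x := by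
  intro x hx
  by_contra hneg
  rw [not_le] at hneg
  have h0 : (0 : ℝ) ∈ Icc 0 R := ⟨le_rfl, hx.1.trans hx.2⟩
  have hcont : ContinuousOn F (Icc 0 R) :=
    (continuousOn_primitive_Icc (hx.1.trans hx.2) hh).congr hF
  have hF0 : F 0 = 0 := by rw [hF 0 h0]; simp
  -- After the last zero `p` before `x`, `F` stays negative, so `h` is nonnegative there and `F x ≥
  -- F p = 0`.
  obtain ⟨p, hp, hp0, hpn⟩ := exists_last_zero hx.1 (hcont.mono (Icc_subset_Icc_right hx.2))
    hF0.ge hneg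
  have hpI : p ∈ Icc 0 R := ⟨hp.1, hp.2.le.trans hx.2⟩
  have h1 : F x - F p = ∫ t in p..x, h t := by
    rw [hF x hx, hF p hpI]
    exact intervalIntegral.integral_interval_sub_left (hh.mono_Icc h0 hx) (hh.mono_Icc h0 hpI)
  have h2 : 0 ≤ ∫ t in p..x, h t := by
    refine intervalIntegral.integral_nonneg_of_ae_restrict hp.2.le ?_
    rw [EventuallyLE, ae_restrict_iff' measurableSet_Icc]
    have hne : ∀ᵐ t : ℝ, t ≠ p ∧ t ≠ R := by
      have h3 : ∀ᵐ t : ℝ, t ≠ p := by simp [ae_iff, measure_singleton]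
      have h4 : ∀ᵐ t : ℝ, t ≠ R := by simp [ae_iff, measure_singleton]
      exact h3.and h4
    filter_upwards [hpos, hne] with t ht htne htI
    have htp : p < t := lt_of_le_of_ne htI.1 (Ne.symm htne.1)
    exact ht ⟨hp.1.trans_lt htp, lt_of_le_of_ne (htI.2.trans hx.2) htne.2⟩ (hpn t ⟨htp, htI.2⟩)
  linarith

/-! ### Elements of `H^1_0(0, L)` as primitives -/

theorem intervalIntegrable_iff_integrable_intervalMeasure {L : ℝ} (hL : 0 ≤ L) {w : ℝ → ℝ} :
    IntervalIntegrable w volume 0 L ↔ Integrable w (intervalMeasure L) :=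
  intervalIntegrable_iff_integrableOn_Ioo_of_le hL

theorem intervalIntegral_eq_setIntegral_Ioo {x : ℝ} (hx : 0 ≤ x) (w : ℝ → ℝ) :
    ∫ t in (0 : ℝ)..x, w t = ∫ t in Ioo 0 x, w t := by
  rw [intervalIntegral.integral_of_le hx, integral_Ioc_eq_integral_Ioo]

theorem MeasureTheory.MemLp.intervalIntegrable_two {L : ℝ} (hL : 0 ≤ L) {w : ℝ → ℝ}
    (hw : MemLp w 2 (intervalMeasure L)) : IntervalIntegrable w volume 0 L :=
  (intervalIntegrable_iff_integrable_intervalMeasure hL).mpr (hw.integrable one_le_two)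

theorem intervalIntegral_congr_ae_intervalMeasure {L x y : ℝ} {v w : ℝ → ℝ}
    (h : v =ᵐ[intervalMeasure L] w) (hx : x ∈ Icc 0 L) (hy : y ∈ Icc 0 L) :
    ∫ t in x..y, v t = ∫ t in x..y, w t := by
  refine intervalIntegral.integral_congr_ae ?_
  rw [EventuallyEq, ae_restrict_iff' measurableSet_Ioo] at h
  have h3 : ∀ᵐ t : ℝ, t ≠ 0 := by simp [ae_iff, measure_singleton]
  have h4 : ∀ᵐ t : ℝ, t ≠ L := by simp [ae_iff, measure_singleton]
  filter_upwards [h, h3, h4] with t ht h0 h1 htI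
  have := (uIcc_subset_Icc hx hy) (uIoc_subset_uIcc htI)
  exact ht ⟨lt_of_le_of_ne this.1 (Ne.symm h0), lt_of_le_of_ne this.2 h1⟩

namespace SobolevZero

variable {L : ℝ}

theorem apply_eq_zero (u : SobolevZero L) {x : ℝ} (hx : x ∉ Ioo 0 L) : u x = 0 := u.2.1 x hx

theorem continuous_apply (u : SobolevZero L) : Continuous u := u.1.1.continuous

theorem norm_eq (u : SobolevZero L) : ‖u‖ = ‖u.weakDeriv‖ := rfl

theorem intervalIntegrable_weakDeriv (hL : 0 ≤ L) (u : SobolevZero L) :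
    IntervalIntegrable u.weakDeriv volume 0 L :=
  (Lp.memLp u.weakDeriv).intervalIntegrable_two hL

theorem hasWeakDeriv_primitive (hL : 0 ≤ L) {w : ℝ → ℝ} (hw : IntervalIntegrable w volume 0 L) :
    HasWeakDeriv L (fun x => ∫ t in (0 : ℝ)..x, w t) w := by
  intro ψ hψ
  rw [← intervalIntegral_eq_setIntegral_Ioo hL, ← intervalIntegral_eq_setIntegral_Ioo hL]
  refine integral_primitive_mul_deriv hw (hψ.contDiff.of_le (by simp)) ?_
  exact image_eq_zero_of_notMem_tsupport fun h => by simpa using hψ.tsupport_subset h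

/-- An element of `H^1_0(0, L)` is the primitive of its derivative. -/
theorem eq_integral (hL : 0 < L) (u : SobolevZero L) {x : ℝ} (hx : x ∈ Icc 0 L) :
    u x = ∫ t in (0 : ℝ)..x, u.weakDeriv t := by
  have hw := u.intervalIntegrable_weakDeriv hL.le
  set P : ℝ → ℝ := fun x => ∫ t in (0 : ℝ)..x, u.weakDeriv t with hP
  have hPc : ContinuousOn P (Icc 0 L) := continuousOn_primitive_Icc hL.le hw
  have hPi : Integrable P (intervalMeasure L) :=
    (hPc.integrableOn_Icc).mono_set Ioo_subset_Icc_self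
  have hui : Integrable u (intervalMeasure L) :=
    (u.continuous_apply.continuousOn.integrableOn_Icc (a := 0) (b := L)).mono_set
      Ioo_subset_Icc_self
  -- `u - P` has zero distributional derivative, hence is constant; both functions vanish at `0`.
  obtain ⟨k, hk⟩ := exists_ae_eq_const_of_integral_mul_deriv_eq_zero hL (u := fun x => u x - P x)
    (hui.sub hPi) (by
      intro ψ hψ
      simp only [sub_mul]
      rw [integral_sub (hψ.integrable_mul_deriv hui) (hψ.integrable_mul_deriv hPi), u.2.2 ψ hψ,
        hasWeakDeriv_primitive hL.le hw ψ hψ]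
      exact sub_self _)
  have heq : EqOn (fun x => u x - P x) (fun _ => k) (Ioo 0 L) :=
    Measure.eqOn_open_of_ae_eq (μ := volume) hk isOpen_Ioo
      (u.continuous_apply.continuousOn.sub (hPc.mono Ioo_subset_Icc_self)) continuous_const.continuousOn
  have hcl : EqOn (fun x => u x - P x) (fun _ => k) (Icc 0 L) :=
    heq.of_subset_closure (u.continuous_apply.continuousOn.sub hPc) continuous_const.continuousOn
      Ioo_subset_Icc_self (by rw [closure_Ioo hL.ne])
  have h0 := hcl (left_mem_Icc.mpr hL.le)
  have hx' := hcl hx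
  simp only [hP, intervalIntegral.integral_same, u.apply_eq_zero (x := 0) (by simp)] at h0 hx'
  linarith

/-- A square integrable function with zero mean is the derivative of its primitive,
an element of `H^1_0(0, L)`. -/
theorem exists_weakDeriv_ae_eq (hL : 0 < L) {w : ℝ → ℝ} (hw : MemLp w 2 (intervalMeasure L))
    (h0 : ∫ t in (0 : ℝ)..L, w t = 0) :
    ∃ u : SobolevZero L, u.weakDeriv =ᵐ[intervalMeasure L] w ∧
      ∀ x ∈ Icc 0 L, u x = ∫ t in (0 : ℝ)..x, w t := by
  have hwi := hw.intervalIntegrable_two hL.le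
  set P : ℝ → ℝ := fun x => ∫ t in (0 : ℝ)..x, w t with hP
  have hPc : ContinuousOn P (Icc 0 L) := continuousOn_primitive_Icc hL.le hwi
  -- Clamping the argument extends `P` by its end values, both zero because `w` has zero mean.
  set Q : ℝ → ℝ := fun x => P (max 0 (min x L)) with hQ
  have hQc : Continuous Q := by
    refine hPc.comp_continuous (by fun_prop) fun x => ?_
    exact ⟨le_max_left _ _, max_le hL.le (min_le_right _ _)⟩
  have hQP : ∀ x ∈ Icc 0 L, Q x = P x := by
    intro x hx
    simp only [hQ]
    rw [min_eq_left hx.2, max_eq_right hx.1]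
  have hQ0 : ∀ x ∉ Ioo 0 L, Q x = 0 := by
    intro x hx
    rw [mem_Ioo, not_and_or, not_lt, not_lt] at hx
    simp only [hQ]
    rcases hx with hx | hx
    · rw [max_eq_left ((min_le_left _ _).trans hx)]
      simp [hP]
    · rw [min_eq_right hx, max_eq_right hL.le]
      exact h0
  have hWD : HasWeakDeriv L Q (hw.toLp w) := by
    intro ψ hψ
    have h1 := hasWeakDeriv_primitive hL.le hwi ψ hψ
    have h2 : ∫ x in Ioo 0 L, (hw.toLp w : ℝ → ℝ) x * ψ x = ∫ x in Ioo 0 L, w x * ψ x := by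
      refine integral_congr_ae ?_
      filter_upwards [hw.coeFn_toLp] with x hx
      rw [hx]
    rw [h2, ← h1]
    refine setIntegral_congr_fun measurableSet_Ioo fun x hx => ?_
    simp only [hQP x (Ioo_subset_Icc_self hx), hP]
  refine ⟨⟨(⟨Q, hQc⟩, hw.toLp w), hQ0, hWD⟩, hw.coeFn_toLp, hQP⟩

theorem ext_of_eqOn (hL : 0 < L) {u v : SobolevZero L} (h : ∀ x ∈ Ioo 0 L, u x = v x) : u = v := by
  refine weakDeriv_injective ?_
  have h1 : ∀ x, u x = v x := fun x => by
    by_cases hx : x ∈ Ioo 0 L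
    · exact h x hx
    · rw [u.apply_eq_zero hx, v.apply_eq_zero hx]
  have hsub : ∀ᵐ x ∂(intervalMeasure L), u.weakDeriv x - v.weakDeriv x = 0 := by
    have hu := u.intervalIntegrable_weakDeriv hL.le
    have hv := v.intervalIntegrable_weakDeriv hL.le
    refine ae_eq_zero_of_forall_integral_eq_zero hL.le (hu.sub hv) fun x hx => ?_
    have h0 : (0 : ℝ) ∈ Icc 0 L := left_mem_Icc.mpr hL.le
    rw [intervalIntegral.integral_sub (hu.mono_Icc h0 hx) (hv.mono_Icc h0 hx),
      ← u.eq_integral hL hx, ← v.eq_integral hL hx, h1 x, sub_self]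
  refine Lp.ext ?_
  filter_upwards [hsub] with x hx
  linarith

end SobolevZero

/-! ### The integrated form of the equation -/

section Equation

variable {L : ℝ} {a g : ℝ → ℝ} {φ : ℝ → EReal}

theorem memLp_bdd_mul {μ : Measure ℝ} {a w : ℝ → ℝ} {C : ℝ} (ha : AEStronglyMeasurable a μ)
    (hab : ∀ᵐ x ∂μ, |a x| ≤ C) (hw : MemLp w 2 μ) : MemLp (fun x => a x * w x) 2 μ :=
  hw.of_le_mul (c := C) (ha.mul hw.1) (by
    filter_upwards [hab] with x hx
    rw [norm_mul]
    exact mul_le_mul_of_nonneg_right hx (norm_nonneg _))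

/-- A weak solution satisfies the once integrated equation. -/
theorem IsWeakSolution.exists_const {C : ℝ} (hL : 0 < L)
    (ha : AEStronglyMeasurable a (intervalMeasure L))
    (hab : ∀ᵐ x ∂(intervalMeasure L), |a x| ≤ C) (hg : MemLp g 2 (intervalMeasure L))
    {u : SobolevZero L} (hu : IsWeakSolution L a g φ u) :
    ∃ c : ℝ, ∀ᵐ x ∂(intervalMeasure L),
      a x * u.weakDeriv x = (φ (u x)).toReal + g x + c := by
  have h1 : Integrable (fun x => a x * u.weakDeriv x) (intervalMeasure L) :=
    (memLp_bdd_mul ha hab (Lp.memLp u.weakDeriv)).integrable one_le_two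
  have h2 := hu.memLp.integrable one_le_two
  have h3 := hg.integrable one_le_two
  obtain ⟨k, hk⟩ := exists_ae_eq_const_of_integral_mul_deriv_eq_zero hL
    (u := fun x => a x * u.weakDeriv x - ((φ (u x)).toReal + g x)) (h1.sub (h2.add h3)) (by
      intro ψ hψ
      have h4 : Integrable (fun x => (φ (u x)).toReal * deriv ψ x + g x * deriv ψ x)
        (intervalMeasure L) := (hψ.integrable_mul_deriv h2).add (hψ.integrable_mul_deriv h3)
      simp only [sub_mul, add_mul]
      rw [integral_sub (hψ.integrable_mul_deriv h1) h4,
        integral_add (hψ.integrable_mul_deriv h2) (hψ.integrable_mul_deriv h3),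
        hu.equation ψ hψ, sub_self])
  refine ⟨k, ?_⟩
  filter_upwards [hk] with x hx
  linarith

/-- This is why the integration constant is invisible in the weak formulation. -/
theorem IsTestFunction.integral_deriv {ψ : ℝ → ℝ} (hL : 0 ≤ L) (hψ : IsTestFunction L ψ) :
    ∫ x in Ioo 0 L, deriv ψ x = 0 := by
  have hψ0 : ∀ x ∉ Ioo 0 L, ψ x = 0 := fun x hx =>
    image_eq_zero_of_notMem_tsupport fun h => hx (hψ.tsupport_subset h)
  rw [← intervalIntegral_eq_setIntegral_Ioo hL, intervalIntegral.integral_deriv_eq_sub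
    (fun x _ => hψ.contDiff.differentiable (by simp) x)
    (hψ.continuous_deriv.intervalIntegrable _ _), hψ0 L (by simp), hψ0 0 (by simp), sub_zero]

/-- A function of `H^1_0(0, L)` satisfying the once integrated equation is a weak solution. -/
theorem isWeakSolution_of_ae_eq (hL : 0 < L) (hg : MemLp g 2 (intervalMeasure L))
    {u : SobolevZero L} (hfin : ∀ᵐ x ∂(intervalMeasure L), φ (u x) ≠ ⊤ ∧ φ (u x) ≠ ⊥)
    (hLp : MemLp (fun x => (φ (u x)).toReal) 2 (intervalMeasure L)) {c : ℝ}
    (h : ∀ᵐ x ∂(intervalMeasure L), a x * u.weakDeriv x = (φ (u x)).toReal + g x + c) :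
    IsWeakSolution L a g φ u := by
  refine ⟨hfin, hLp, fun ψ hψ => ?_⟩
  have h2 := hψ.integrable_mul_deriv (hLp.integrable one_le_two)
  have h3 := hψ.integrable_mul_deriv (hg.integrable one_le_two)
  have h4 := hψ.integrable_mul_deriv (integrable_const c)
  have h5 : ∫ x in Ioo 0 L, a x * u.weakDeriv x * deriv ψ x =
      ∫ x in Ioo 0 L, ((φ (u x)).toReal * deriv ψ x + g x * deriv ψ x + c * deriv ψ x) := by
    refine integral_congr_ae ?_
    filter_upwards [h] with x hx
    rw [hx]
    ring
  have h6 : Integrable (fun x => (φ (u x)).toReal * deriv ψ x + g x * deriv ψ x)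
    (intervalMeasure L) := h2.add h3
  rw [h5, integral_add h6 h4, integral_add h2 h3, integral_const_mul,
    hψ.integral_deriv hL.le, mul_zero, add_zero]

end Equation

theorem ae_imp_of_ae_intervalMeasure {L : ℝ} {P : ℝ → Prop} (h : ∀ᵐ x ∂(intervalMeasure L), P x) :
    ∀ᵐ x : ℝ, x ∈ Icc 0 L → P x := by
  rw [ae_restrict_iff' measurableSet_Ioo] at h
  have h3 : ∀ᵐ t : ℝ, t ≠ 0 := by simp [ae_iff, measure_singleton]
  have h4 : ∀ᵐ t : ℝ, t ≠ L := by simp [ae_iff, measure_singleton]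
  filter_upwards [h, h3, h4] with t ht h0 h1 htI
  exact ht ⟨lt_of_le_of_ne htI.1 (Ne.symm h0), lt_of_le_of_ne htI.2 h1⟩

/-! ### A Volterra equation with Lipschitz nonlinearity -/

theorem intervalIntegrable_mul_comp_add {L B : ℝ} (hL : 0 ≤ L) {b G h : ℝ → ℝ}
    (hb : AEStronglyMeasurable b (intervalMeasure L))
    (hbB : ∀ᵐ x ∂(intervalMeasure L), |b x| ≤ B) (hG : Integrable G (intervalMeasure L))
    (hh : ContinuousOn h (Icc 0 L)) :
    IntervalIntegrable (fun t => b t * (h t + G t)) volume 0 L := by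
  rw [intervalIntegrable_iff_integrable_intervalMeasure hL]
  have h1 : Integrable h (intervalMeasure L) := hh.integrableOn_Icc.mono_set Ioo_subset_Icc_self
  exact (h1.add hG).bdd_mul hb hbB

/-- Picard's fixed point in an exponentially weighted norm: with the unknown rescaled by `exp (-(r *
x))`, the integral operator contracts on the whole interval at once. -/
theorem exists_volterra_solution {L B : ℝ} (hL : 0 ≤ L) {K : NNReal} {b G ψ : ℝ → ℝ}
    (hb : AEStronglyMeasurable b (intervalMeasure L))
    (hbB : ∀ᵐ x ∂(intervalMeasure L), |b x| ≤ B) (hG : Integrable G (intervalMeasure L))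
    (hψ : LipschitzWith K ψ) :
    ∃ v : ℝ → ℝ, Continuous v ∧ ∀ x ∈ Icc 0 L, v x = ∫ t in (0 : ℝ)..x, b t * (ψ (v t) + G t) := by
  -- The Lipschitz constant found below is `|B| * K / r`, hence at most `1 / 2`; the `+ 1` keeps `r`
  -- positive.
  set r : ℝ := 2 * (K * |B| + 1) with hr
  have hr0 : 0 < r := by positivity
  have hint : ∀ v : ℝ → ℝ, ContinuousOn v (Icc 0 L) →
      IntervalIntegrable (fun t => b t * (ψ (v t) + G t)) volume 0 L := fun v hv =>
    intervalIntegrable_mul_comp_add hL hb hbB hG (hψ.continuous.comp_continuousOn hv)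
  have hext : ∀ v : C(Icc 0 L, ℝ), Continuous (fun t => Real.exp (r * t) * IccExtend hL v t) :=
    fun v => (by fun_prop : Continuous fun t : ℝ => Real.exp (r * t)).mul v.continuous.Icc_extend'
  let S : C(Icc 0 L, ℝ) → C(Icc 0 L, ℝ) := fun v =>
    ⟨fun x => Real.exp (-(r * x)) *
      ∫ t in (0 : ℝ)..x, b t * (ψ (Real.exp (r * t) * IccExtend hL v t) + G t), by
      refine (by fun_prop : Continuous fun x : Icc 0 L => Real.exp (-(r * x))).mul ?_
      exact (continuousOn_primitive_Icc hL (hint _ (hext v).continuousOn)).domRestrict⟩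
  have hS : ContractingWith (1 / 2) S := by
    refine ⟨by norm_num, LipschitzWith.of_dist_le_mul fun v w => ?_⟩
    rw [ContinuousMap.dist_le (by positivity)]
    intro x
    have h0 : (0 : ℝ) ∈ Icc 0 L := ⟨le_rfl, hL⟩
    have hbd : ‖∫ t in (0 : ℝ)..x, (b t * (ψ (Real.exp (r * t) * IccExtend hL v t) + G t) -
        b t * (ψ (Real.exp (r * t) * IccExtend hL w t) + G t))‖ ≤
        ∫ t in (0 : ℝ)..x, |B| * K * dist v w * Real.exp (r * t) := by
      have hc : Continuous fun t : ℝ => |B| * K * dist v w * Real.exp (r * t) := by fun_prop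
      refine intervalIntegral.norm_integral_le_of_norm_le x.2.1 ?_ (hc.intervalIntegrable _ _)
      filter_upwards [ae_imp_of_ae_intervalMeasure hbB] with t ht htI
      have htI' : t ∈ Icc 0 L := ⟨htI.1.le, htI.2.trans x.2.2⟩
      have h1 : |ψ (Real.exp (r * t) * IccExtend hL v t) - ψ (Real.exp (r * t) * IccExtend hL w t)|
          ≤ K * (Real.exp (r * t) * dist v w) := by
        have h2 := hψ.dist_le_mul (Real.exp (r * t) * IccExtend hL v t)
          (Real.exp (r * t) * IccExtend hL w t)
        rw [Real.dist_eq, Real.dist_eq, ← mul_sub, abs_mul, abs_of_pos (Real.exp_pos _)] at h2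
        refine h2.trans ?_
        gcongr
        rw [IccExtend_of_mem _ _ htI', IccExtend_of_mem _ _ htI', ← Real.dist_eq]
        exact ContinuousMap.dist_apply_le_dist _
      rw [← mul_sub, add_sub_add_right_eq_sub, norm_mul, Real.norm_eq_abs, Real.norm_eq_abs]
      calc |b t| * |ψ (Real.exp (r * t) * IccExtend hL v t) -
            ψ (Real.exp (r * t) * IccExtend hL w t)|
          ≤ |B| * (K * (Real.exp (r * t) * dist v w)) :=
            mul_le_mul ((ht htI').trans (le_abs_self _)) h1 (abs_nonneg _) (abs_nonneg _)
        _ = |B| * K * dist v w * Real.exp (r * t) := by ring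
    have hexp : ∫ t in (0 : ℝ)..x, Real.exp (r * t) ≤ Real.exp (r * x) / r := by
      rw [intervalIntegral.integral_comp_mul_left (fun t => Real.exp t) hr0.ne', integral_exp]
      simp only [mul_zero, Real.exp_zero, smul_eq_mul]
      rw [inv_mul_eq_div]
      gcongr
      linarith
    have hle : |∫ t in (0 : ℝ)..x, (b t * (ψ (Real.exp (r * t) * IccExtend hL v t) + G t) -
        b t * (ψ (Real.exp (r * t) * IccExtend hL w t) + G t))| ≤
        |B| * K * dist v w * (Real.exp (r * x) / r) := by
      refine hbd.trans ?_
      rw [intervalIntegral.integral_const_mul]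
      gcongr
    have hcoe : ∀ v : C(Icc 0 L, ℝ), S v x = Real.exp (-(r * x)) *
      ∫ t in (0 : ℝ)..x, b t * (ψ (Real.exp (r * t) * IccExtend hL v t) + G t) := fun _ => rfl
    rw [Real.dist_eq, hcoe, hcoe, ← mul_sub, abs_mul, abs_of_pos (Real.exp_pos _),
      ← intervalIntegral.integral_sub ((hint _ (hext v).continuousOn).mono_Icc h0 x.2)
        ((hint _ (hext w).continuousOn).mono_Icc h0 x.2)]
    calc _ ≤ Real.exp (-(r * x)) * (|B| * K * dist v w * (Real.exp (r * x) / r)) := by gcongr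
      _ = (Real.exp (-(r * x)) * Real.exp (r * x)) * (|B| * K / r) * dist v w := by ring
      _ = (|B| * K / r) * dist v w := by rw [← Real.exp_add]; simp
      _ ≤ _ := by
        refine mul_le_mul_of_nonneg_right ?_ dist_nonneg
        rw [div_le_iff₀ hr0, hr]
        push_cast
        linarith
  obtain ⟨v, hv⟩ : ∃ v, S v = v := ⟨_, hS.fixedPoint_isFixedPt⟩
  refine ⟨fun t => Real.exp (r * t) * IccExtend hL v t, hext v, fun x hx => ?_⟩
  have h1 : S v ⟨x, hx⟩ = v ⟨x, hx⟩ := by rw [hv]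
  have h2 : S v ⟨x, hx⟩ = Real.exp (-(r * x)) *
      ∫ t in (0 : ℝ)..x, b t * (ψ (Real.exp (r * t) * IccExtend hL v t) + G t) := rfl
  simp only
  rw [IccExtend_of_mem _ _ hx, ← h1, h2, ← mul_assoc, ← Real.exp_add]
  simp

/-! ### Lipschitz regularization from below -/

/-- The largest `n`-Lipschitz function on `ℝ` lying below `f` on `(0, ∞)`. -/
noncomputable def lipReg (f : ℝ → ℝ) (n : ℕ) (s : ℝ) : ℝ := ⨅ t : Ioi (0 : ℝ), (f t + n * |s - t|)

section LipReg

variable {f : ℝ → ℝ} {m : ℝ}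

theorem bddBelow_lipReg (hm : ∀ s > 0, m ≤ f s) (n : ℕ) (s : ℝ) :
    BddBelow (range fun t : Ioi (0 : ℝ) => f t + n * |s - t|) := by
  refine ⟨m, ?_⟩
  rintro _ ⟨t, rfl⟩
  have := hm t t.2
  have : 0 ≤ n * |s - t| := by positivity
  simp only
  linarith

theorem lipReg_le (hm : ∀ s > 0, m ≤ f s) (n : ℕ) (s : ℝ) {t : ℝ} (ht : 0 < t) :
    lipReg f n s ≤ f t + n * |s - t| :=
  ciInf_le (bddBelow_lipReg hm n s) (⟨t, ht⟩ : Ioi (0 : ℝ))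

theorem le_lipReg {n : ℕ} {s K : ℝ} (h : ∀ t > 0, K ≤ f t + n * |s - t|) : K ≤ lipReg f n s := by
  have : Nonempty (Ioi (0 : ℝ)) := ⟨⟨1, mem_Ioi.mpr one_pos⟩⟩
  exact le_ciInf fun t => h t t.2

theorem lipReg_le_self (hm : ∀ s > 0, m ≤ f s) (n : ℕ) {s : ℝ} (hs : 0 < s) :
    lipReg f n s ≤ f s := by
  simpa using lipReg_le hm n s hs

theorem lower_le_lipReg (hm : ∀ s > 0, m ≤ f s) (n : ℕ) (s : ℝ) : m ≤ lipReg f n s :=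
  le_lipReg fun t ht => (hm t ht).trans (le_add_of_nonneg_right (by positivity))

theorem lipReg_mono (hm : ∀ s > 0, m ≤ f s) (s : ℝ) : Monotone fun n => lipReg f n s := by
  intro n k hnk
  refine le_lipReg fun t ht => (lipReg_le hm n s ht).trans ?_
  gcongr

/-- Moving the competitor `t` to `t + (s₂ - s₁)` keeps the penalty and does not increase `f`. -/
theorem lipReg_antitone (hm : ∀ s > 0, m ≤ f s) (hf : AntitoneOn f (Ioi 0)) (n : ℕ) :
    Antitone (lipReg f n) := by
  intro s₁ s₂ hs
  refine le_lipReg fun t ht => ?_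
  have ht' : 0 < t + (s₂ - s₁) := by linarith
  have h1 := lipReg_le hm n s₂ ht'
  have h2 : f (t + (s₂ - s₁)) ≤ f t := hf ht ht' (by linarith)
  have h3 : s₂ - (t + (s₂ - s₁)) = s₁ - t := by ring
  rw [h3] at h1
  linarith

theorem lipschitzWith_lipReg (hm : ∀ s > 0, m ≤ f s) (n : ℕ) : LipschitzWith n (lipReg f n) := by
  refine LipschitzWith.of_le_add_mul _ fun s₁ s₂ => ?_
  rw [← sub_le_iff_le_add]
  refine le_lipReg fun t ht => ?_
  have h1 := lipReg_le hm n s₁ ht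
  have h2 : |s₁ - t| ≤ |s₂ - t| + |s₁ - s₂| := by
    rw [add_comm]
    exact abs_sub_le _ _ _
  have h3 : (n : ℝ) * |s₁ - t| ≤ n * (|s₂ - t| + |s₁ - s₂|) := by gcongr
  rw [Real.dist_eq]
  push_cast
  linarith

/-- Competitors near `s` have almost the value `f s` or more, by continuity; those at distance at
least `δ` pay `n * δ`, which for large `n` outweighs the lower bound `m`. -/
theorem tendsto_lipReg (hm : ∀ s > 0, m ≤ f s) (hf : ContinuousOn f (Ioi 0)) {s : ℝ} (hs : 0 < s) :
    Tendsto (fun n => lipReg f n s) atTop (𝓝 (f s)) := by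
  rw [tendsto_order]
  refine ⟨fun K hK => ?_, fun K hK => Eventually.of_forall fun n =>
    (lipReg_le_self hm n hs).trans_lt hK⟩
  obtain ⟨K', hKK', hK'⟩ := exists_between hK
  have hev : ∀ᶠ t in 𝓝 s, K' < f t :=
    (hf.continuousAt (Ioi_mem_nhds hs)).eventually (lt_mem_nhds hK')
  obtain ⟨δ, hδ, hball⟩ := Metric.eventually_nhds_iff.mp hev
  obtain ⟨N, hN⟩ := exists_nat_ge ((K' - m) / δ)
  filter_upwards [eventually_ge_atTop N] with n hn
  refine hKK'.trans_le (le_lipReg fun t ht => ?_)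
  by_cases htd : dist t s < δ
  · exact (hball htd).le.trans (le_add_of_nonneg_right (by positivity))
  · rw [not_lt, dist_comm, Real.dist_eq] at htd
    have h1 : (K' - m) / δ ≤ n := hN.trans (by exact_mod_cast hn)
    rw [div_le_iff₀ hδ] at h1
    have h2 : (n : ℝ) * δ ≤ n * |s - t| := by gcongr
    linarith [hm t ht]

end LipReg

/-! ### Integral inequalities and a chain rule for positive primitives. -/

theorem mul_le_integral_of_ae_le {h : ℝ → ℝ} {x y κ : ℝ} (hxy : x ≤ y)
    (hh : IntervalIntegrable h volume x y) (hκ : ∀ᵐ t, t ∈ Icc x y → κ ≤ h t) :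
    κ * (y - x) ≤ ∫ t in x..y, h t := by
  have h1 : ∫ _ in x..y, κ = κ * (y - x) := by simp [mul_comm]
  rw [← h1]
  refine intervalIntegral.integral_mono_ae_restrict hxy (by simp) hh ?_
  rw [EventuallyLE, ae_restrict_iff' measurableSet_Icc]
  exact hκ

/-- Square of the `L^2` norm. -/
theorem MeasureTheory.MemLp.toReal_eLpNorm_two_sq {μ : Measure ℝ} {w : ℝ → ℝ} (hw : MemLp w 2 μ) :
    (eLpNorm w 2 μ).toReal ^ 2 = ∫ x, w x ^ 2 ∂μ := by
  have h0 : 0 ≤ ∫ x, w x ^ 2 ∂μ := integral_nonneg fun x => sq_nonneg _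
  rw [hw.eLpNorm_eq_integral_rpow_norm (by simp) (by simp), ENNReal.toReal_ofReal (by positivity)]
  simp only [ENNReal.toReal_ofNat, Real.rpow_ofNat, Real.norm_eq_abs, sq_abs]
  rw [← Real.rpow_mul_natCast h0]
  simp

/-- The Cauchy-Schwarz inequality with one factor equal to `1`. -/
theorem integral_abs_sq_le {L x y : ℝ} (hx : x ∈ Icc 0 L) (hy : y ∈ Icc 0 L) (hxy : x ≤ y)
    {w : ℝ → ℝ} (hw : MemLp w 2 (intervalMeasure L)) :
    (∫ t in x..y, |w t|) ^ 2 ≤ (y - x) * ∫ t in Ioo 0 L, w t ^ 2 := by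
  have hL : 0 ≤ L := hx.1.trans hx.2
  have hsqI : IntervalIntegrable (fun t => w t ^ 2) volume 0 L :=
    (intervalIntegrable_iff_integrable_intervalMeasure hL).mpr hw.integrable_sq
  have hw1 : IntervalIntegrable (fun t => |w t|) volume x y :=
    ((hw.intervalIntegrable_two hL).mono_Icc hx hy).abs
  have hw2 := hsqI.mono_Icc hx hy
  have hmono : ∫ t in x..y, w t ^ 2 ≤ ∫ t in Ioo 0 L, w t ^ 2 := by
    rw [← intervalIntegral_eq_setIntegral_Ioo hL]
    exact intervalIntegral.integral_mono_interval hx.1 hxy hy.2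
      (Eventually.of_forall fun t => sq_nonneg _) hsqI
  rcases hxy.eq_or_lt with rfl | hlt
  · simp
  set I := ∫ t in x..y, |w t| with hI
  have hd : 0 < y - x := sub_pos.mpr hlt
  -- The integrand is the square of `|w t|` minus its mean.
  have h1 : 0 ≤ ∫ t in x..y, (w t ^ 2 - 2 * (I / (y - x)) * |w t| + (I / (y - x)) ^ 2) := by
    refine intervalIntegral.integral_nonneg hxy fun t _ => ?_
    have := sq_nonneg (|w t| - I / (y - x))
    rw [← sq_abs (w t)]
    linarith
  rw [intervalIntegral.integral_add (hw2.sub (hw1.const_mul _)) (by simp),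
    intervalIntegral.integral_sub hw2 (hw1.const_mul _), intervalIntegral.integral_const_mul,
    ← hI] at h1
  simp only [intervalIntegral.integral_const, smul_eq_mul] at h1
  have h2 : (y - x) * (I / (y - x)) ^ 2 = I ^ 2 / (y - x) := by field_simp
  have h3 : 2 * (I / (y - x)) * I = 2 * (I ^ 2 / (y - x)) := by ring
  rw [h2, h3] at h1
  have h4 : I ^ 2 / (y - x) ≤ ∫ t in Ioo 0 L, w t ^ 2 := by linarith
  rw [div_le_iff₀ hd] at h4
  linarith

/-- Chain rule for `f ∘ v` where `f` is continuous on `(0, ∞)` and `v` is a positive primitive. -/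
theorem integral_comp_mul_of_pos {f w v : ℝ → ℝ} {p q : ℝ} (hf : ContinuousOn f (Ioi 0))
    (hw : IntervalIntegrable w volume p q)
    (hv : ∀ x ∈ uIcc p q, v x = v p + ∫ t in p..x, w t) (hpos : ∀ x ∈ uIcc p q, 0 < v x) :
    ∫ t in p..q, f (v t) * w t = ∫ s in (v p)..(v q), f s := by
  have hvc : ContinuousOn v (uIcc p q) := by
    refine ContinuousOn.congr ?_ hv
    exact continuousOn_const.add (intervalIntegral.continuousOn_primitive_interval' hw left_mem_uIcc)
  obtain ⟨z, hz, hmin⟩ := isCompact_uIcc.exists_isMinOn nonempty_uIcc hvc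
  set δ := v z with hδ
  have hδ0 : 0 < δ := hpos z hz
  have hmin' : ∀ x ∈ uIcc p q, δ ≤ v x := fun x hx => hmin hx
  -- By compactness `v ≥ δ > 0`. Freezing `f` below `δ` makes it continuous on the whole line
  -- without changing either integral.
  set F : ℝ → ℝ := fun s => f (max s δ) with hF
  have hFc : Continuous F := hf.comp_continuous (by fun_prop) fun s => hδ0.trans_le (le_max_right _ _)
  have h1 := integral_comp_mul_of_primitive hFc hw hv
  have h2 : ∫ t in p..q, F (v t) * w t = ∫ t in p..q, f (v t) * w t := by
    refine intervalIntegral.integral_congr fun t ht => ?_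
    simp only [hF]
    rw [max_eq_left (hmin' t ht)]
  have h3 : ∫ s in (v p)..(v q), F s = ∫ s in (v p)..(v q), f s := by
    refine intervalIntegral.integral_congr fun s hs => ?_
    simp only [hF]
    have hs' : δ ≤ s := (le_inf (hmin' p left_mem_uIcc) (hmin' q right_mem_uIcc)).trans hs.1
    rw [max_eq_left hs']
  rw [← h2, h1, h3]

/-! ### The singular boundary value problem -/

/-- The hypotheses on the coefficient `a`, the datum `g` and the restriction `f` of the
nonlinearity to `(0, ∞)`, which is bounded below by `m`. -/
structure IsAdmissible (L α β m : ℝ) (a g f : ℝ → ℝ) : Prop where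
  hL : 0 < L
  hα : 0 < α
  ha : AEStronglyMeasurable a (intervalMeasure L)
  hab : ∀ᵐ x ∂(intervalMeasure L), α ≤ a x ∧ a x ≤ β
  hg : MemLp g 2 (intervalMeasure L)
  hg_below : ∀ η ∈ Ioo 0 L, ∃ M : ℝ, 0 < M ∧ ∀ᵐ x ∂(volume.restrict (Icc 0 (L - η))), -M ≤ g x
  f_cont : ContinuousOn f (Ioi 0)
  f_anti : AntitoneOn f (Ioi 0)
  f_lower : ∀ s > 0, m ≤ f s
  f_top : Tendsto f (𝓝[>] 0) atTop
  f_int : ∀ R, IntegrableOn f (Ioo 0 R)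

/-- The derivative prescribed by the once integrated equation. -/
noncomputable def slopeField (a g f : ℝ → ℝ) (c : ℝ) (v : ℝ → ℝ) (t : ℝ) : ℝ :=
  (a t)⁻¹ * (f (v t) + (g t + c))

/-- `v` is a positive solution of the once integrated equation with integration constant `c`,
vanishing at `0` and `L`. -/
structure IsProfile (L : ℝ) (a g f : ℝ → ℝ) (c : ℝ) (v : ℝ → ℝ) : Prop where
  pos : ∀ x ∈ Ioo 0 L, 0 < v x
  memLp : MemLp (fun x => f (v x)) 2 (intervalMeasure L)
  eq_integral : ∀ x ∈ Icc 0 L, v x = ∫ t in (0 : ℝ)..x, slopeField a g f c v t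
  right : v L = 0

namespace IsAdmissible

variable {L α β m : ℝ} {a g f : ℝ → ℝ}

theorem hβ (h : IsAdmissible L α β m a g f) : α ≤ β := by
  have : (intervalMeasure L) ≠ 0 := by
    simp [Measure.restrict_eq_zero, h.hL]
  have : (ae (intervalMeasure L)).NeBot := ae_neBot.mpr this
  obtain ⟨x, hx⟩ := h.hab.exists
  exact hx.1.trans hx.2

theorem hβ_pos (h : IsAdmissible L α β m a g f) : 0 < β := h.hα.trans_le h.hβ

theorem ae_inv (h : IsAdmissible L α β m a g f) :
    ∀ᵐ x ∂(intervalMeasure L), β⁻¹ ≤ (a x)⁻¹ ∧ (a x)⁻¹ ≤ α⁻¹ := by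
  filter_upwards [h.hab] with x hx
  have hα := h.hα
  exact ⟨inv_anti₀ (hα.trans_le hx.1) hx.2, inv_anti₀ hα hx.1⟩

theorem ae_abs_inv (h : IsAdmissible L α β m a g f) :
    ∀ᵐ x ∂(intervalMeasure L), |(a x)⁻¹| ≤ α⁻¹ := by
  have h1 := inv_pos.mpr h.hβ_pos
  filter_upwards [h.ae_inv] with x hx
  rw [abs_of_pos (h1.trans_le hx.1)]
  exact hx.2

theorem aestronglyMeasurable_inv (h : IsAdmissible L α β m a g f) :
    AEStronglyMeasurable (fun x => (a x)⁻¹) (intervalMeasure L) :=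
  h.ha.aemeasurable.inv.aestronglyMeasurable

theorem memLp_datum (h : IsAdmissible L α β m a g f) (c : ℝ) :
    MemLp (fun x => g x + c) 2 (intervalMeasure L) :=
  h.hg.add (memLp_const c)

theorem memLp_slopeField (h : IsAdmissible L α β m a g f) {c : ℝ} {v : ℝ → ℝ}
    (hv : MemLp (fun x => f (v x)) 2 (intervalMeasure L)) :
    MemLp (slopeField a g f c v) 2 (intervalMeasure L) :=
  memLp_bdd_mul h.aestronglyMeasurable_inv h.ae_abs_inv (hv.add (h.memLp_datum c))

theorem intervalIntegrable_slopeField (h : IsAdmissible L α β m a g f) {c : ℝ} {v : ℝ → ℝ}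
    (hv : MemLp (fun x => f (v x)) 2 (intervalMeasure L)) :
    IntervalIntegrable (slopeField a g f c v) volume 0 L :=
  (h.memLp_slopeField hv).intervalIntegrable_two h.hL.le

theorem intervalIntegrable_f (h : IsAdmissible L α β m a g f) {x y : ℝ} (hx : 0 ≤ x) (hy : 0 ≤ y) :
    IntervalIntegrable f volume x y := by
  have h1 : IntervalIntegrable f volume 0 (max x y) := by
    rw [intervalIntegrable_iff_integrableOn_Ioo_of_le (hx.trans (le_max_left _ _))]
    exact h.f_int _
  exact h1.mono_Icc ⟨hx, le_max_left _ _⟩ ⟨hy, le_max_right _ _⟩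

theorem continuousOn_primitive_f (h : IsAdmissible L α β m a g f) :
    ContinuousOn (fun s => ∫ r in (0 : ℝ)..s, f r) (Ici 0) := by
  intro s hs
  have h1 := continuousOn_primitive_Icc (a := 0) (b := s + 1) (by linarith [mem_Ici.mp hs])
    (h.intervalIntegrable_f le_rfl (by linarith [mem_Ici.mp hs]))
  refine (h1 s ⟨hs, by linarith⟩).mono_of_mem_nhdsWithin ?_
  rw [← Ici_inter_Iic]
  exact inter_mem self_mem_nhdsWithin (mem_nhdsWithin_of_mem_nhds (Iic_mem_nhds (by linarith)))

end IsAdmissible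

/-! ### Comparison of profiles with different integration constants. -/

namespace IsProfile

variable {L α β m c c₁ c₂ : ℝ} {a g f v v₁ v₂ : ℝ → ℝ}

theorem continuousOn (hv : IsProfile L a g f c v) (h : IsAdmissible L α β m a g f) :
    ContinuousOn v (Icc 0 L) :=
  (continuousOn_primitive_Icc h.hL.le (h.intervalIntegrable_slopeField hv.memLp)).congr
    hv.eq_integral

theorem left (hv : IsProfile L a g f c v) (h : IsAdmissible L α β m a g f) : v 0 = 0 := by
  rw [hv.eq_integral 0 (left_mem_Icc.mpr h.hL.le)]
  simp

theorem nonneg (hv : IsProfile L a g f c v) (h : IsAdmissible L α β m a g f) :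
    ∀ x ∈ Icc 0 L, 0 ≤ v x := by
  intro x hx
  rcases hx.1.eq_or_lt with h0 | h0
  · rw [← h0, hv.left h]
  rcases hx.2.eq_or_lt with h1 | h1
  · rw [h1, hv.right]
  · exact (hv.pos x ⟨h0, h1⟩).le

theorem sub_eq_integral (hv : IsProfile L a g f c v) (h : IsAdmissible L α β m a g f) {x y : ℝ}
    (hx : x ∈ Icc 0 L) (hy : y ∈ Icc 0 L) : v y - v x = ∫ t in x..y, slopeField a g f c v t := by
  have hi := h.intervalIntegrable_slopeField hv.memLp (c := c)
  have h0 := left_mem_Icc.mpr h.hL.le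
  rw [hv.eq_integral y hy, hv.eq_integral x hx]
  exact intervalIntegral.integral_interval_sub_left (hi.mono_Icc h0 hy) (hi.mono_Icc h0 hx)

theorem integral_slopeField (hv : IsProfile L a g f c v) (h : IsAdmissible L α β m a g f) :
    ∫ t in (0 : ℝ)..L, slopeField a g f c v t = 0 := by
  rw [← hv.eq_integral L (right_mem_Icc.mpr h.hL.le), hv.right]

/-- Profiles are monotone with respect to the integration constant. -/
theorem le_of_le (hv₁ : IsProfile L a g f c₁ v₁) (hv₂ : IsProfile L a g f c₂ v₂)
    (h : IsAdmissible L α β m a g f) (hc : c₁ ≤ c₂) : ∀ x ∈ Icc 0 L, v₁ x ≤ v₂ x := by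
  have hi₁ := h.intervalIntegrable_slopeField hv₁.memLp (c := c₁)
  have hi₂ := h.intervalIntegrable_slopeField hv₂.memLp (c := c₂)
  have h0 := left_mem_Icc.mpr h.hL.le
  -- Where `v₂ < v₁`, monotonicity gives `f (v₁ x) ≤ f (v₂ x)`: the difference has nonnegative slope
  -- wherever it is negative.
  have key := primitive_nonneg (F := fun x => v₂ x - v₁ x) (hi₂.sub hi₁) (fun x hx => by
    rw [intervalIntegral.integral_sub (hi₂.mono_Icc h0 hx) (hi₁.mono_Icc h0 hx),
      ← hv₁.eq_integral x hx, ← hv₂.eq_integral x hx]) (by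
    filter_upwards [ae_imp_of_ae_intervalMeasure h.ae_inv] with x hx hxI hneg
    have hx' := hx (Ioo_subset_Icc_self hxI)
    have h1 : f (v₁ x) ≤ f (v₂ x) :=
      h.f_anti (hv₂.pos x hxI) (hv₁.pos x hxI) (by linarith)
    have h2 : 0 < (a x)⁻¹ := (inv_pos.mpr h.hβ_pos).trans_le hx'.1
    simp only [slopeField]
    rw [← mul_sub]
    exact mul_nonneg h2.le (by linarith))
  intro x hx
  linarith [key x hx]

theorem eqOn (hv₁ : IsProfile L a g f c v₁) (hv₂ : IsProfile L a g f c v₂)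
    (h : IsAdmissible L α β m a g f) : EqOn v₁ v₂ (Icc 0 L) := fun x hx =>
  le_antisymm (hv₁.le_of_le hv₂ h le_rfl x hx) (hv₂.le_of_le hv₁ h le_rfl x hx)

/-- Profiles depend in a Lipschitz way on the integration constant. -/
theorem sub_le (hv₁ : IsProfile L a g f c₁ v₁) (hv₂ : IsProfile L a g f c₂ v₂)
    (h : IsAdmissible L α β m a g f) (hc : c₁ ≤ c₂) :
    ∀ x ∈ Icc 0 L, v₂ x - v₁ x ≤ (c₂ - c₁) / α * x := by
  have hi₁ := h.intervalIntegrable_slopeField hv₁.memLp (c := c₁)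
  have hi₂ := h.intervalIntegrable_slopeField hv₂.memLp (c := c₂)
  have h0 := left_mem_Icc.mpr h.hL.le
  have hk : IntervalIntegrable (fun _ : ℝ => (c₂ - c₁) / α) volume 0 L := by simp
  -- Since `v₁ ≤ v₂`, the contribution of `f` to the slope of `v₂ - v₁` is nonpositive, and only
  -- `(c₂ - c₁) / α` remains as an upper bound.
  have key := primitive_nonneg (F := fun x => (c₂ - c₁) / α * x - (v₂ x - v₁ x))
    (hk.sub (hi₂.sub hi₁)) (fun x hx => by
      rw [intervalIntegral.integral_sub (hk.mono_Icc h0 hx) ((hi₂.sub hi₁).mono_Icc h0 hx),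
        intervalIntegral.integral_sub (hi₂.mono_Icc h0 hx) (hi₁.mono_Icc h0 hx),
        ← hv₁.eq_integral x hx, ← hv₂.eq_integral x hx]
      simp only [intervalIntegral.integral_const, smul_eq_mul, sub_zero]
      ring) (by
    filter_upwards [ae_imp_of_ae_intervalMeasure h.ae_inv] with x hx hxI _
    have hx' := hx (Ioo_subset_Icc_self hxI)
    have h1 : f (v₂ x) ≤ f (v₁ x) := h.f_anti (hv₁.pos x hxI) (hv₂.pos x hxI)
      (hv₁.le_of_le hv₂ h hc x (Ioo_subset_Icc_self hxI))
    have h2 : 0 < (a x)⁻¹ := (inv_pos.mpr h.hβ_pos).trans_le hx'.1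
    simp only [slopeField]
    rw [← mul_sub, sub_nonneg, div_eq_inv_mul]
    calc _ ≤ (a x)⁻¹ * (c₂ - c₁) := mul_le_mul_of_nonneg_left (by linarith) h2.le
      _ ≤ α⁻¹ * (c₂ - c₁) := mul_le_mul_of_nonneg_right hx'.2 (by linarith))
  intro x hx
  linarith [key x hx]

theorem continuousAt (hv : IsProfile L a g f c v) (h : IsAdmissible L α β m a g f) {x : ℝ}
    (hx : x ∈ Ioo 0 L) : ContinuousAt v x :=
  (hv.continuousOn h).continuousAt (Icc_mem_nhds hx.1 hx.2)

theorem continuousAt_comp (hv : IsProfile L a g f c v) (h : IsAdmissible L α β m a g f) {x : ℝ}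
    (hx : x ∈ Ioo 0 L) : ContinuousAt (fun x => f (v x)) x :=
  (h.f_cont.continuousAt (Ioi_mem_nhds (hv.pos x hx))).comp (hv.continuousAt h hx)

/-- If the profiles touched at `x`, then near `x` the values of `f` would differ by less than `(c₂ -
c₁) / 2`, and `v₂ - v₁` would have slope at least `(c₂ - c₁) / (2 β)`. It would then be negative
just before `x`, against the weak comparison. -/
theorem lt_of_lt (hv₁ : IsProfile L a g f c₁ v₁) (hv₂ : IsProfile L a g f c₂ v₂)
    (h : IsAdmissible L α β m a g f) (hc : c₁ < c₂) : ∀ x ∈ Ioo 0 L, v₁ x < v₂ x := by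
  intro x hx
  have hxI := Ioo_subset_Icc_self hx
  refine lt_of_le_of_ne (hv₁.le_of_le hv₂ h hc.le x hxI) fun heq => ?_
  have hcont : ContinuousAt (fun y => f (v₁ y) - f (v₂ y)) x :=
    (hv₁.continuousAt_comp h hx).sub (hv₂.continuousAt_comp h hx)
  have hev : ∀ᶠ y in 𝓝 x, f (v₁ y) - f (v₂ y) < (c₂ - c₁) / 2 := by
    refine hcont.eventually (gt_mem_nhds ?_)
    simp only [heq, sub_self]
    linarith
  obtain ⟨δ, hδ, hball⟩ := Metric.eventually_nhds_iff.mp hev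
  set y := max (x / 2) (x - δ / 2) with hy
  have hyx : y < x := max_lt (by linarith [hx.1]) (by linarith)
  have hy0 : 0 < y := lt_of_lt_of_le (by linarith [hx.1]) (le_max_left _ _)
  have hyI : y ∈ Icc 0 L := ⟨hy0.le, hyx.le.trans hx.2.le⟩
  have hyd : x - δ / 2 ≤ y := le_max_right _ _
  have hi₁ := (h.intervalIntegrable_slopeField hv₁.memLp (c := c₁)).mono_Icc hyI hxI
  have hi₂ := (h.intervalIntegrable_slopeField hv₂.memLp (c := c₂)).mono_Icc hyI hxI
  have h1 := mul_le_integral_of_ae_le (κ := β⁻¹ * ((c₂ - c₁) / 2)) hyx.le (hi₂.sub hi₁) (by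
    filter_upwards [ae_imp_of_ae_intervalMeasure h.ae_inv] with t ht htI
    have ht' := ht ⟨hyI.1.trans htI.1, htI.2.trans hxI.2⟩
    have h2 : f (v₁ t) - f (v₂ t) < (c₂ - c₁) / 2 := by
      refine hball ?_
      rw [Real.dist_eq, abs_lt]
      constructor <;> linarith [htI.1, htI.2]
    simp only [slopeField]
    rw [← mul_sub]
    exact mul_le_mul ht'.1 (by linarith) (by linarith)
      ((inv_pos.mpr h.hβ_pos).le.trans ht'.1))
  rw [intervalIntegral.integral_sub hi₂ hi₁, ← hv₁.sub_eq_integral h hyI hxI,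
    ← hv₂.sub_eq_integral h hyI hxI, heq] at h1
  have h3 := hv₁.le_of_le hv₂ h hc.le y hyI
  have h4 : 0 < β⁻¹ * ((c₂ - c₁) / 2) * (x - y) := by
    have := inv_pos.mpr h.hβ_pos
    have : 0 < (c₂ - c₁) / 2 := by linarith
    have : 0 < x - y := by linarith
    positivity
  linarith

end IsProfile

/-! ### Energy estimate -/

/-- Young's inequality absorbs `G * w` in half of the coercive term. The splitting is left free: `c`
is put with `f (v x)` for profiles, and with `g x` for interior solutions. -/
theorem half_mul_sq_le {α A w F G : ℝ} (hα : 0 < α) (hA : α ≤ A) (h : A * w = F + G) :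
    α / 2 * w ^ 2 ≤ F * w + (2 * α)⁻¹ * G ^ 2 := by
  have h6 : α * w ^ 2 ≤ A * w * w := by
    rw [mul_assoc, ← sq]
    exact mul_le_mul_of_nonneg_right hA (sq_nonneg _)
  rw [h] at h6
  have h8 := mul_nonneg (inv_nonneg.mpr (by positivity : 0 ≤ 2 * α)) (sq_nonneg (G - α * w))
  have h9 : (2 * α)⁻¹ * (G - α * w) ^ 2 = (2 * α)⁻¹ * G ^ 2 + α / 2 * w ^ 2 - G * w := by
    field_simp
    ring
  linarith

theorem mul_slopeField {a g f v : ℝ → ℝ} {c x : ℝ} (ha : a x ≠ 0) :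
    a x * slopeField a g f c v x = f (v x) + (g x + c) := by
  rw [slopeField, ← mul_assoc, mul_inv_cancel₀ ha, one_mul]

namespace IsProfile

variable {L α β m c c₁ c₂ : ℝ} {a g f v v₁ v₂ : ℝ → ℝ}

/-- The integrand is the derivative of a primitive of `f` composed with `v`, and `v` vanishes at
both ends. The chain rule needs `v > 0`, so the identity is first obtained inside `(0, L)`;
integrability of `f` at `0` makes the primitive continuous there and carries it to the endpoints. -/
theorem integral_comp_mul_slopeField (hv : IsProfile L a g f c v)
    (h : IsAdmissible L α β m a g f) :
    ∫ t in (0 : ℝ)..L, f (v t) * slopeField a g f c v t = 0 := by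
  have hL := h.hL
  have hw := h.memLp_slopeField hv.memLp (c := c)
  have hwi := h.intervalIntegrable_slopeField hv.memLp (c := c)
  have hprod : IntervalIntegrable (fun t => f (v t) * slopeField a g f c v t) volume 0 L :=
    (intervalIntegrable_iff_integrable_intervalMeasure hL.le).mpr (hv.memLp.integrable_mul hw)
  set H : ℝ → ℝ := fun x => (∫ t in (0 : ℝ)..x, f (v t) * slopeField a g f c v t) -
    ∫ s in (0 : ℝ)..(v x), f s with hH
  have hHc : ContinuousOn H (Icc 0 L) :=
    (continuousOn_primitive_Icc hL.le hprod).sub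
      (h.continuousOn_primitive_f.comp (hv.continuousOn h) (hv.nonneg h))
  have h0 := left_mem_Icc.mpr hL.le
  have hmid : L / 2 ∈ Ioo 0 L := ⟨by linarith, by linarith⟩
  have hconst : EqOn H (fun _ => H (L / 2)) (Ioo 0 L) := by
    intro x hx
    have hsub : uIcc (L / 2) x ⊆ Ioo 0 L := OrdConnected.uIcc_subset ordConnected_Ioo hmid hx
    have hmI := Ioo_subset_Icc_self hmid
    have hxI := Ioo_subset_Icc_self hx
    have h1 := integral_comp_mul_of_pos (p := L / 2) (q := x) h.f_cont (hwi.mono_Icc hmI hxI)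
      (v := v) (fun y hy => by
        rw [← hv.sub_eq_integral h hmI (Ioo_subset_Icc_self (hsub hy))]
        ring) (fun y hy => hv.pos y (hsub hy))
    have h2 := intervalIntegral.integral_interval_sub_left (hprod.mono_Icc h0 hxI)
      (hprod.mono_Icc h0 hmI)
    have h3 := intervalIntegral.integral_interval_sub_left
      (h.intervalIntegrable_f le_rfl (hv.pos x hx).le)
      (h.intervalIntegrable_f le_rfl (hv.pos _ hmid).le)
    simp only [hH]
    linarith
  have hcl : EqOn H (fun _ => H (L / 2)) (Icc 0 L) :=
    hconst.of_subset_closure hHc continuousOn_const Ioo_subset_Icc_self (by rw [closure_Ioo hL.ne])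
  have h1 := (hcl h0).trans (hcl (right_mem_Icc.mpr hL.le)).symm
  simp only [hH, hv.right, hv.left h, intervalIntegral.integral_same, sub_zero] at h1
  exact h1.symm

/-- The energy estimate for profiles. -/
theorem integral_slopeField_sq_le (hv : IsProfile L a g f c v) (h : IsAdmissible L α β m a g f) :
    ∫ x in Ioo 0 L, slopeField a g f c v x ^ 2 ≤ (∫ x in Ioo 0 L, g x ^ 2) / α ^ 2 := by
  have hα := h.hα
  have hw := h.memLp_slopeField hv.memLp (c := c)
  set w := slopeField a g f c v with hwdef
  have h1 : ∫ x in Ioo 0 L, f (v x) * w x = 0 := by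
    rw [← intervalIntegral_eq_setIntegral_Ioo h.hL.le]
    exact hv.integral_comp_mul_slopeField h
  have h2 : ∫ x in Ioo 0 L, w x = 0 := by
    rw [← intervalIntegral_eq_setIntegral_Ioo h.hL.le]
    exact hv.integral_slopeField h
  have i1 : Integrable (fun x => f (v x) * w x) (intervalMeasure L) := hv.memLp.integrable_mul hw
  have i2 : Integrable (fun x => c * w x) (intervalMeasure L) :=
    (hw.integrable one_le_two).const_mul c
  have i3 : Integrable (fun x => (2 * α)⁻¹ * g x ^ 2) (intervalMeasure L) :=
    h.hg.integrable_sq.const_mul _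
  have i4 : Integrable (fun x => α / 2 * w x ^ 2) (intervalMeasure L) :=
    hw.integrable_sq.const_mul _
  have i12 : Integrable (fun x => f (v x) * w x + c * w x) (intervalMeasure L) := i1.add i2
  have i123 : Integrable (fun x => f (v x) * w x + c * w x + (2 * α)⁻¹ * g x ^ 2)
    (intervalMeasure L) := i12.add i3
  have h3 : ∫ x in Ioo 0 L, α / 2 * w x ^ 2 ≤
      ∫ x in Ioo 0 L, (f (v x) * w x + c * w x + (2 * α)⁻¹ * g x ^ 2) := by
    refine integral_mono_ae i4 i123 ?_
    filter_upwards [h.hab] with x hx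
    have h4 := mul_slopeField (g := g) (f := f) (v := v) (c := c) (hα.trans_le hx.1).ne'
    -- The term `c * w x` has zero integral, so the resulting bound does not depend on `c`.
    have h5 := half_mul_sq_le hα hx.1 (h4.trans (by ring : _ = (f (v x) + c) + g x))
    linarith
  rw [integral_add i12 i3, integral_add i1 i2, integral_const_mul, integral_const_mul,
    integral_const_mul, h1, h2] at h3
  rw [le_div_iff₀ (by positivity)]
  have h4 : (2 * α)⁻¹ * (∫ x in Ioo 0 L, g x ^ 2) * (2 * α) = ∫ x in Ioo 0 L, g x ^ 2 := by
    field_simp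
  nlinarith [mul_le_mul_of_nonneg_right h3 (by positivity : 0 ≤ 2 * α)]

/-- The integration constant is bounded from above. -/
theorem const_le (hv : IsProfile L a g f c v) (h : IsAdmissible L α β m a g f) :
    c ≤ 1 / √L * (β / α + 1) * (eLpNorm g 2 (intervalMeasure L)).toReal - m := by
  have hα := h.hα
  have hL := h.hL
  have hβ := h.hβ_pos
  set Γ := (eLpNorm g 2 (intervalMeasure L)).toReal with hΓ
  have hΓ0 : 0 ≤ Γ := ENNReal.toReal_nonneg
  have hw := h.memLp_slopeField hv.memLp (c := c)
  set w := slopeField a g f c v with hwdef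
  have h0 := left_mem_Icc.mpr hL.le
  have h1 := right_mem_Icc.mpr hL.le
  have hcs1 := integral_abs_sq_le h0 h1 hL.le hw
  have hcs2 := integral_abs_sq_le h0 h1 hL.le h.hg
  rw [← h.hg.toReal_eLpNorm_two_sq, ← hΓ, sub_zero] at hcs2
  have henergy := hv.integral_slopeField_sq_le h
  rw [← h.hg.toReal_eLpNorm_two_sq, ← hΓ, ← hwdef] at henergy
  have hsL : √L ^ 2 = L := Real.sq_sqrt hL.le
  have hw' : ∫ t in (0 : ℝ)..L, |w t| ≤ √L * Γ / α := by
    refine abs_le_of_sq_le_sq' ?_ (by positivity) |>.2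
    rw [div_pow, mul_pow, hsL]
    rw [sub_zero] at hcs1
    calc _ ≤ _ := hcs1
      _ ≤ L * (Γ ^ 2 / α ^ 2) := by gcongr
      _ = _ := by ring
  have hg' : ∫ t in (0 : ℝ)..L, |g t| ≤ √L * Γ := by
    refine abs_le_of_sq_le_sq' ?_ (by positivity) |>.2
    rw [mul_pow, hsL]
    exact hcs2
  have i1 := (hw.intervalIntegrable_two hL.le).abs
  have i2 := (h.hg.intervalIntegrable_two hL.le).abs
  -- The equation gives `c + m ≤ a w - g` pointwise; both terms on the right are then controlled by
  -- Cauchy-Schwarz and the energy estimate.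
  have h2 : ∫ t in (0 : ℝ)..L, (c + m) ≤ ∫ t in (0 : ℝ)..L, (β * |w t| + |g t|) := by
    refine intervalIntegral.integral_mono_ae_restrict hL.le (by simp) ((i1.const_mul β).add i2) ?_
    rw [← restrict_Ioo_eq_restrict_Icc]
    filter_upwards [h.hab, ae_restrict_mem measurableSet_Ioo] with x hx hxI
    have ha0 : 0 < a x := hα.trans_le hx.1
    have h4 : a x * w x = f (v x) + (g x + c) := mul_slopeField ha0.ne'
    have h5 : a x * w x ≤ β * |w x| :=
      (mul_le_mul_of_nonneg_left (le_abs_self _) ha0.le).trans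
        (mul_le_mul_of_nonneg_right hx.2 (abs_nonneg _))
    have h6 := h.f_lower _ (hv.pos x hxI)
    have h7 := neg_abs_le (g x)
    linarith
  rw [intervalIntegral.integral_add (i1.const_mul β) i2, intervalIntegral.integral_const_mul] at h2
  simp only [intervalIntegral.integral_const, sub_zero, smul_eq_mul] at h2
  have h3 : L * (c + m) ≤ √L * Γ * (β / α + 1) := by
    have := mul_le_mul_of_nonneg_left hw' hβ.le
    calc _ ≤ _ := h2
      _ ≤ β * (√L * Γ / α) + √L * Γ := by linarith
      _ = _ := by ring
  have hs0 : 0 < √L := Real.sqrt_pos.mpr hL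
  have h4 : c + m ≤ (√L * Γ * (β / α + 1)) / L := by
    rw [le_div_iff₀ hL]
    linarith
  have h5 : (√L * Γ * (β / α + 1)) / L = 1 / √L * (β / α + 1) * Γ := by
    nth_rewrite 2 [← hsL]
    field_simp
  linarith

end IsProfile

/-! ### Comparison, passage to the limit and regularity for integrated equations. -/

namespace IsAdmissible

variable {L α β m c : ℝ} {a g f : ℝ → ℝ}

/-- Comparison of two primitives. -/
theorem comparison (h : IsAdmissible L α β m a g f) {F₁ F₂ h₁ h₂ : ℝ → ℝ}
    (i₁ : IntervalIntegrable (fun t => (a t)⁻¹ * h₁ t) volume 0 L)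
    (i₂ : IntervalIntegrable (fun t => (a t)⁻¹ * h₂ t) volume 0 L)
    (e₁ : ∀ x ∈ Icc 0 L, F₁ x = ∫ t in (0 : ℝ)..x, (a t)⁻¹ * h₁ t)
    (e₂ : ∀ x ∈ Icc 0 L, F₂ x = ∫ t in (0 : ℝ)..x, (a t)⁻¹ * h₂ t)
    (hcmp : ∀ t ∈ Ioo 0 L, F₂ t < F₁ t → h₁ t ≤ h₂ t) : ∀ x ∈ Icc 0 L, F₁ x ≤ F₂ x := by
  have h0 := left_mem_Icc.mpr h.hL.le
  have key := primitive_nonneg (F := fun x => F₂ x - F₁ x) (i₂.sub i₁) (fun x hx => by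
    rw [intervalIntegral.integral_sub (i₂.mono_Icc h0 hx) (i₁.mono_Icc h0 hx), ← e₁ x hx,
      ← e₂ x hx]) (by
    filter_upwards [ae_imp_of_ae_intervalMeasure h.ae_inv] with x hx hxI hneg
    have hx' := hx (Ioo_subset_Icc_self hxI)
    have h1 := hcmp x hxI (by linarith)
    have h2 : 0 < (a x)⁻¹ := (inv_pos.mpr h.hβ_pos).trans_le hx'.1
    rw [← mul_sub]
    exact mul_nonneg h2.le (by linarith))
  intro x hx
  linarith [key x hx]

/-- Passage to the limit in the integrated equation. -/
theorem tendsto_integral_inv_mul (h : IsAdmissible L α β m a g f) {H : ℕ → ℝ → ℝ}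
    {H' B : ℝ → ℝ} {cs : ℕ → ℝ} {x : ℝ} (hx : x ∈ Icc 0 L)
    (hH : ∀ n, AEStronglyMeasurable (H n) (intervalMeasure L))
    (hB : ∀ᶠ n in atTop, ∀ t ∈ Ioo 0 x, |H n t| ≤ B t) (hBi : IntervalIntegrable B volume 0 x)
    (hlim : ∀ t ∈ Ioo 0 x, Tendsto (fun n => H n t) atTop (𝓝 (H' t)))
    (hc : Tendsto cs atTop (𝓝 c)) :
    IntervalIntegrable (fun t => (a t)⁻¹ * (H' t + (g t + c))) volume 0 x ∧
    Tendsto (fun n => ∫ t in (0 : ℝ)..x, (a t)⁻¹ * (H n t + (g t + cs n))) atTop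
      (𝓝 (∫ t in (0 : ℝ)..x, (a t)⁻¹ * (H' t + (g t + c)))) := by
  have hsub : Ioo 0 x ⊆ Ioo 0 L := Ioo_subset_Ioo_right hx.2
  have hle : volume.restrict (Ioo 0 x) ≤ intervalMeasure L := Measure.restrict_mono hsub le_rfl
  have hα : 0 < α⁻¹ := inv_pos.mpr h.hα
  have hgi : Integrable g (volume.restrict (Ioo 0 x)) :=
    (h.hg.integrable one_le_two).mono_measure hle
  have hBi' : Integrable B (volume.restrict (Ioo 0 x)) :=
    (intervalIntegrable_iff_integrable_intervalMeasure hx.1).mp hBi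
  set bound : ℝ → ℝ := fun t => α⁻¹ * (B t + (|g t| + (|c| + 1))) with hbound
  have hbi : Integrable bound (volume.restrict (Ioo 0 x)) :=
    (hBi'.add (hgi.abs.add (integrable_const _))).const_mul _
  have hmeas : ∀ n, AEStronglyMeasurable (fun t => (a t)⁻¹ * (H n t + (g t + cs n)))
      (volume.restrict (Ioo 0 x)) := fun n =>
    (h.aestronglyMeasurable_inv.mono_measure hle).mul
      (((hH n).mono_measure hle).add (hgi.1.add aestronglyMeasurable_const))
  have hcs : ∀ᶠ n in atTop, |cs n| ≤ |c| + 1 := by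
    filter_upwards [hc.abs.eventually (gt_mem_nhds (lt_add_one |c|))] with n hn using hn.le
  have hbd : ∀ᶠ n in atTop, ∀ᵐ t ∂(volume.restrict (Ioo 0 x)),
      ‖(a t)⁻¹ * (H n t + (g t + cs n))‖ ≤ bound t := by
    filter_upwards [hB, hcs] with n hn hcn
    filter_upwards [hle.absolutelyContinuous.ae_le h.ae_abs_inv,
      ae_restrict_mem measurableSet_Ioo] with t ht htI
    rw [norm_mul, Real.norm_eq_abs, Real.norm_eq_abs]
    refine mul_le_mul ht ?_ (abs_nonneg _) hα.le
    exact (abs_add_le _ _).trans (add_le_add (hn t htI)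
      ((abs_add_le _ _).trans (add_le_add le_rfl hcn)))
  have hl : ∀ᵐ t ∂(volume.restrict (Ioo 0 x)),
      Tendsto (fun n => (a t)⁻¹ * (H n t + (g t + cs n))) atTop
        (𝓝 ((a t)⁻¹ * (H' t + (g t + c)))) := by
    filter_upwards [ae_restrict_mem measurableSet_Ioo] with t htI
    exact ((hlim t htI).add (hc.const_add _)).const_mul _
  constructor
  · rw [intervalIntegrable_iff_integrable_intervalMeasure hx.1]
    refine hbi.mono' (aestronglyMeasurable_of_tendsto_ae _ hmeas hl) ?_
    obtain ⟨N, hN⟩ := eventually_atTop.mp hbd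
    have hall : ∀ᵐ t ∂(volume.restrict (Ioo 0 x)), ∀ n : ℕ,
        ‖(a t)⁻¹ * (H (N + n) t + (g t + cs (N + n)))‖ ≤ bound t :=
      ae_all_iff.mpr fun n => hN _ (Nat.le_add_right _ _)
    filter_upwards [hall, hl] with t ht htl
    refine le_of_tendsto htl.norm ?_
    filter_upwards [eventually_ge_atTop N] with n hn
    simpa [Nat.add_sub_cancel' hn] using ht (n - N)
  · simp only [intervalIntegral_eq_setIntegral_Ioo hx.1]
    exact tendsto_integral_filter_of_dominated_convergence bound
      (Eventually.of_forall hmeas) hbd hbi hl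

/-- Interior solutions which stay bounded have a square integrable derivative. -/
theorem memLp_slopeField_of_interior (h : IsAdmissible L α β m a g f) {v : ℝ → ℝ} {R : ℝ}
    (hv : ContinuousOn v (Ioo 0 L)) (hpos : ∀ x ∈ Ioo 0 L, 0 < v x) (hR : ∀ x ∈ Ioo 0 L, v x ≤ R)
    (hw : ∀ p ∈ Ioo 0 L, ∀ q ∈ Ioo 0 L, p ≤ q →
      IntervalIntegrable (slopeField a g f c v) volume p q ∧
      v q = v p + ∫ t in p..q, slopeField a g f c v t) :
    MemLp (slopeField a g f c v) 2 (intervalMeasure L) := by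
  have hL := h.hL
  have hα := h.hα
  set w := slopeField a g f c v with hwdef
  -- As `0 < v ≤ R`, `C₀` bounds the primitive of `f` along `v`. So the energy on `[p, q]` is
  -- bounded independently of `p` and `q`, without any boundary condition.
  set C₀ : ℝ := ∫ s in (0 : ℝ)..R, |f s| with hC₀
  set G₀ : ℝ := ∫ x in Ioo 0 L, (g x + c) ^ 2 with hG₀
  have hR0 : 0 ≤ R := by
    have hmid : L / 2 ∈ Ioo 0 L := ⟨by linarith, by linarith⟩
    exact (hpos _ hmid).le.trans (hR _ hmid)
  have hloc : ∀ p ∈ Ioo 0 L, ∀ q ∈ Ioo 0 L, p ≤ q →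
      MemLp w 2 (volume.restrict (Ioc p q)) ∧ ∫ x in Ioc p q, ‖w x ^ 2‖ ≤
        2 / α * (2 * C₀ + (2 * α)⁻¹ * G₀) := by
    intro p hp q hq hpq
    have hsub : Icc p q ⊆ Ioo 0 L := fun x hx => ⟨hp.1.trans_le hx.1, hx.2.trans_lt hq.2⟩
    have hle : volume.restrict (Ioc p q) ≤ intervalMeasure L :=
      Measure.restrict_mono (Ioc_subset_Icc_self.trans hsub) le_rfl
    have hfc : ContinuousOn (fun x => f (v x)) (Icc p q) :=
      h.f_cont.comp (hv.mono hsub) fun x hx => hpos x (hsub hx)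
    have hfL : MemLp (fun x => f (v x)) 2 (volume.restrict (Ioc p q)) := by
      obtain ⟨C, hC⟩ := isCompact_Icc.exists_bound_of_continuousOn hfc
      refine MemLp.of_bound ((hfc.mono Ioc_subset_Icc_self).aestronglyMeasurable measurableSet_Ioc)
        C ?_
      filter_upwards [ae_restrict_mem measurableSet_Ioc] with x hx
      exact hC x (Ioc_subset_Icc_self hx)
    have hGL : MemLp (fun x => g x + c) 2 (volume.restrict (Ioc p q)) :=
      (h.memLp_datum c).mono_measure hle
    have hinv := hle.absolutelyContinuous.ae_le h.ae_abs_inv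
    have hwL : MemLp w 2 (volume.restrict (Ioc p q)) :=
      memLp_bdd_mul (h.aestronglyMeasurable_inv.mono_measure hle) hinv (hfL.add hGL)
    refine ⟨hwL, ?_⟩
    have hchain : ∫ t in p..q, f (v t) * w t = ∫ s in (v p)..(v q), f s := by
      refine integral_comp_mul_of_pos h.f_cont (hw p hp q hq hpq).1 ?_ ?_
      · intro x hx
        rw [uIcc_of_le hpq] at hx
        exact (hw p hp x (hsub hx) hx.1).2
      · intro x hx
        rw [uIcc_of_le hpq] at hx
        exact hpos x (hsub hx)
    have hΦ : ∀ s ∈ Icc 0 R, |∫ r in (0 : ℝ)..s, f r| ≤ C₀ := by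
      intro s hs
      refine (intervalIntegral.abs_integral_le_integral_abs hs.1).trans ?_
      exact intervalIntegral.integral_mono_interval le_rfl hs.1 hs.2
        (Eventually.of_forall fun _ => abs_nonneg _) (h.intervalIntegrable_f le_rfl hR0).abs
    have hp' : v p ∈ Icc 0 R := ⟨(hpos p hp).le, hR p hp⟩
    have hq' : v q ∈ Icc 0 R := ⟨(hpos q hq).le, hR q hq⟩
    have hchain' : ∫ t in p..q, f (v t) * w t ≤ 2 * C₀ := by
      rw [hchain, ← intervalIntegral.integral_interval_sub_left
        (h.intervalIntegrable_f le_rfl hq'.1) (h.intervalIntegrable_f le_rfl hp'.1)]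
      have h1 := (abs_le.mp (hΦ _ hp')).1
      have h2 := (abs_le.mp (hΦ _ hq')).2
      linarith
    rw [intervalIntegral.integral_of_le hpq] at hchain'
    have i1 : Integrable (fun x => f (v x) * w x) (volume.restrict (Ioc p q)) :=
      hfL.integrable_mul hwL
    have i2 : Integrable (fun x => (2 * α)⁻¹ * (g x + c) ^ 2) (volume.restrict (Ioc p q)) :=
      hGL.integrable_sq.const_mul _
    have i3 : Integrable (fun x => α / 2 * w x ^ 2) (volume.restrict (Ioc p q)) :=
      hwL.integrable_sq.const_mul _
    have h3 : ∫ x in Ioc p q, α / 2 * w x ^ 2 ≤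
        ∫ x in Ioc p q, (f (v x) * w x + (2 * α)⁻¹ * (g x + c) ^ 2) := by
      refine integral_mono_ae i3 (i1.add i2) ?_
      filter_upwards [hle.absolutelyContinuous.ae_le h.hab] with x hx
      exact half_mul_sq_le hα hx.1 (mul_slopeField (hα.trans_le hx.1).ne')
    have h4 : ∫ x in Ioc p q, (g x + c) ^ 2 ≤ G₀ :=
      setIntegral_mono_set (h.memLp_datum c).integrable_sq
        (Eventually.of_forall fun _ => sq_nonneg _)
        (Ioc_subset_Icc_self.trans hsub).eventuallyLE
    rw [integral_add i1 i2, integral_const_mul, integral_const_mul] at h3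
    have h5 : (2 * α)⁻¹ * ∫ x in Ioc p q, (g x + c) ^ 2 ≤ (2 * α)⁻¹ * G₀ := by gcongr
    simp only [Real.norm_eq_abs, abs_pow, sq_abs]
    have h6 : α / 2 * ∫ x in Ioc p q, w x ^ 2 ≤ 2 * C₀ + (2 * α)⁻¹ * G₀ := by linarith
    calc ∫ x in Ioc p q, w x ^ 2 = 2 / α * (α / 2 * ∫ x in Ioc p q, w x ^ 2) := by field_simp
      _ ≤ _ := by gcongr
  -- Exhaustion of `(0, L)`; the shift by `3` keeps the endpoints in order from `n = 0` on.
  have hp : ∀ n : ℕ, L / (n + 3 : ℝ) ∈ Ioo 0 L ∧ L - L / (n + 3 : ℝ) ∈ Ioo 0 L ∧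
      L / (n + 3 : ℝ) ≤ L - L / (n + 3 : ℝ) := by
    intro n
    have h1 : (0 : ℝ) < n + 3 := by positivity
    have h2 : 0 < L / (n + 3 : ℝ) := by positivity
    have h3 : L / (n + 3 : ℝ) ≤ L / 3 :=
      div_le_div_of_nonneg_left hL.le (by norm_num) (by linarith [(Nat.cast_nonneg n : (0 : ℝ) ≤ n)])
    exact ⟨⟨h2, by linarith⟩, ⟨by linarith, by linarith⟩, by linarith⟩
  have hlim : Tendsto (fun n : ℕ => L / (n + 3 : ℝ)) atTop (𝓝 0) :=
    tendsto_const_nhds.div_atTop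
      (tendsto_atTop_add_const_right _ _ tendsto_natCast_atTop_atTop)
  have hlim' : Tendsto (fun n : ℕ => L - L / (n + 3 : ℝ)) atTop (𝓝 L) := by
    simpa using hlim.const_sub L
  have hmeas : AEStronglyMeasurable w (intervalMeasure L) :=
    h.aestronglyMeasurable_inv.mul (AEStronglyMeasurable.add
      ((h.f_cont.comp hv fun x hx => hpos x hx).aestronglyMeasurable measurableSet_Ioo)
      (h.memLp_datum c).1)
  rw [memLp_two_iff_integrable_sq hmeas]
  have := integrableOn_Ioc_of_intervalIntegral_norm_bounded (f := fun x => w x ^ 2)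
    (fun n : ℕ => (hloc _ (hp n).1 _ (hp n).2.1 (hp n).2.2).1.integrable_sq) hlim hlim'
    (Eventually.of_forall fun n : ℕ => (hloc _ (hp n).1 _ (hp n).2.1 (hp n).2.2).2)
  exact this.mono_set Ioo_subset_Ioc_self

end IsAdmissible

/-! ### Existence of profiles for smaller constants and for increasing limits of constants. -/

namespace IsAdmissible

variable {L α β m c c₀ : ℝ} {a g f v₀ : ℝ → ℝ}

/-- Uniform lower barrier for the solutions of the regularized equations. -/
theorem exists_barrier (h : IsAdmissible L α β m a g f) {v : ℕ → ℝ → ℝ}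
    (hi : ∀ n, IntervalIntegrable (fun t => (a t)⁻¹ * (lipReg f n (v n t) + (g t + c))) volume 0 L)
    (hv : ∀ n, ∀ x ∈ Icc 0 L,
      v n x = ∫ t in (0 : ℝ)..x, (a t)⁻¹ * (lipReg f n (v n t) + (g t + c)))
    {η : ℝ} (hη : η ∈ Ioo 0 L) :
    ∃ κ > 0, ∃ N, ∀ n ≥ N, ∀ x ∈ Icc 0 (L - η), κ * x ≤ v n x := by
  have hL := h.hL
  have hβ := inv_pos.mpr h.hβ_pos
  obtain ⟨M, -, hM⟩ := h.hg_below η hη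
  -- Below height `δ`, the regularized right-hand side is at least `1` for `n ≥ N`, so the slope is
  -- at least `β⁻¹`. The bound `κ ≤ δ / L` keeps the line `κ * x` below `δ`, and `κ ≤ β⁻¹` makes it
  -- rise no faster than the solution.
  obtain ⟨δ, hδK, hδ⟩ : ∃ δ, M + |c| + 1 < f δ ∧ 0 < δ :=
    ((h.f_top.eventually_gt_atTop (M + |c| + 1)).and self_mem_nhdsWithin).exists
  obtain ⟨N, hN⟩ := eventually_atTop.mp
    ((tendsto_lipReg h.f_lower h.f_cont hδ).eventually (lt_mem_nhds hδK))
  refine ⟨min β⁻¹ (δ / L), lt_min hβ (by positivity), N, fun n hn => ?_⟩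
  set κ := min β⁻¹ (δ / L) with hκ
  have hsub : Icc 0 (L - η) ⊆ Icc 0 L := Icc_subset_Icc_right (by linarith [hη.1])
  have h0 := left_mem_Icc.mpr hL.le
  have hk : IntervalIntegrable (fun _ : ℝ => κ) volume 0 L := by simp
  have hR : L - η ∈ Icc 0 L := ⟨by linarith [hη.2], by linarith [hη.1]⟩
  rw [ae_restrict_iff' measurableSet_Icc] at hM
  have key := primitive_nonneg (F := fun x => v n x - κ * x)
    (((hi n).sub hk).mono_Icc h0 hR) (fun x hx => by
      rw [intervalIntegral.integral_sub ((hi n).mono_Icc h0 (hsub hx)) (hk.mono_Icc h0 (hsub hx)),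
        ← hv n x (hsub hx)]
      simp [mul_comm]) (by
    filter_upwards [ae_imp_of_ae_intervalMeasure h.ae_inv, hM] with x hx hgx hxI hneg
    have hxI' := Ioo_subset_Icc_self hxI
    have hx' := hx (hsub hxI')
    have hle : v n x ≤ δ := by
      have h1 : κ * x ≤ δ / L * L :=
        mul_le_mul (min_le_right _ _) (hsub hxI').2 hxI.1.le (by positivity)
      rw [div_mul_cancel₀ _ hL.ne'] at h1
      linarith
    have h2 := lipReg_antitone h.f_lower h.f_anti n hle
    have h3 := hN n hn
    have h4 := hgx hxI'
    have h5 := neg_abs_le c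
    have h6 : β⁻¹ * 1 ≤ (a x)⁻¹ * (lipReg f n (v n x) + (g x + c)) :=
      mul_le_mul hx'.1 (by linarith) zero_le_one (hβ.le.trans hx'.1)
    have h7 : κ ≤ β⁻¹ := min_le_left _ _
    linarith)
  intro x hx
  linarith [key x hx]

/-- If there is a profile for the constant `c₀`, there is one for every smaller constant. -/
theorem exists_profile_of_le (h : IsAdmissible L α β m a g f) (hv₀ : IsProfile L a g f c₀ v₀)
    (hc : c ≤ c₀) : ∃ v, IsProfile L a g f c v := by
  have hL := h.hL
  have h0 := left_mem_Icc.mpr hL.le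
  have hG : Integrable (fun t => g t + c) (intervalMeasure L) :=
    (h.memLp_datum c).integrable one_le_two
  -- The regularizations increase with `n` and lie below `f`, and `c ≤ c₀`; by comparison the `v n`
  -- increase and stay below `v₀`.
  choose v hvc hv using fun n : ℕ => exists_volterra_solution hL.le h.aestronglyMeasurable_inv
    h.ae_abs_inv hG (lipschitzWith_lipReg h.f_lower n)
  have hi : ∀ n, IntervalIntegrable (fun t => (a t)⁻¹ * (lipReg f n (v n t) + (g t + c)))
      volume 0 L := fun n => intervalIntegrable_mul_comp_add hL.le h.aestronglyMeasurable_inv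
    h.ae_abs_inv hG ((lipschitzWith_lipReg h.f_lower n).continuous.comp (hvc n)).continuousOn
  have hmono : ∀ x ∈ Icc 0 L, Monotone fun n => v n x := by
    intro x hx n k hnk
    refine h.comparison (hi n) (hi k) (hv n) (hv k) (fun t _ hlt => ?_) x hx
    have h1 := lipReg_antitone h.f_lower h.f_anti n hlt.le
    have h2 := lipReg_mono h.f_lower (v k t) hnk
    simp only at h2
    linarith
  have hle : ∀ n, ∀ x ∈ Icc 0 L, v n x ≤ v₀ x := by
    intro n
    refine h.comparison (hi n) (h.intervalIntegrable_slopeField hv₀.memLp) (hv n) hv₀.eq_integral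
      fun t ht hlt => ?_
    have h1 := lipReg_antitone h.f_lower h.f_anti n hlt.le
    have h2 := lipReg_le_self h.f_lower n (hv₀.pos t ht)
    linarith
  set V : ℝ → ℝ := fun x => ⨆ n, v n x with hV
  have hbdd : ∀ x ∈ Icc 0 L, BddAbove (range fun n => v n x) := by
    intro x hx
    refine ⟨v₀ x, ?_⟩
    rintro _ ⟨n, rfl⟩
    exact hle n x hx
  have hVlim : ∀ x ∈ Icc 0 L, Tendsto (fun n => v n x) atTop (𝓝 (V x)) := fun x hx =>
    tendsto_atTop_ciSup (hmono x hx) (hbdd x hx)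
  have hvV : ∀ n, ∀ x ∈ Icc 0 L, v n x ≤ V x := fun n x hx => le_ciSup (hbdd x hx) n
  have hV₀ : ∀ x ∈ Icc 0 L, V x ≤ v₀ x := fun x hx => ciSup_le fun n => hle n x hx
  have hVpos : ∀ x ∈ Ioo 0 L, 0 < V x := by
    intro x hx
    obtain ⟨κ, hκ, N, hN⟩ := h.exists_barrier hi hv (η := L - x)
      ⟨by linarith [hx.2], by linarith [hx.1]⟩
    have h1 := hN N le_rfl x ⟨hx.1.le, by linarith⟩
    have h2 : 0 < κ * x := mul_pos hκ hx.1
    linarith [hvV N x (Ioo_subset_Icc_self hx)]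
  have hlimit : ∀ x ∈ Ioo 0 L, IntervalIntegrable (slopeField a g f c V) volume 0 x ∧
      V x = ∫ t in (0 : ℝ)..x, slopeField a g f c V t := by
    intro x hx
    have hxI := Ioo_subset_Icc_self hx
    obtain ⟨κ, hκ, N, hN⟩ := h.exists_barrier hi hv (η := L - x)
      ⟨by linarith [hx.2], by linarith [hx.1]⟩
    have hlow : ∀ n ≥ N, ∀ t ∈ Ioo 0 x, κ * t ≤ v n t := fun n hn t ht =>
      hN n hn t ⟨ht.1.le, by linarith [ht.2]⟩
    -- The barrier `κ * t ≤ v n t` turns the integrability of `f` at `0` into a dominating function.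
    -- It is available only on `[0, x]` with `x < L`, since `g` need not be bounded below near `L`.
    have hBi : IntervalIntegrable (fun t => |f (κ * t)| + |m|) volume 0 x := by
      have h1 := (h.intervalIntegrable_f (x := 0) (y := κ * x) le_rfl
        (mul_pos hκ hx.1).le).comp_mul_left (c := κ)
      rw [zero_div, mul_div_cancel_left₀ _ hκ.ne'] at h1
      exact h1.abs.add (by simp)
    obtain ⟨h1, h2⟩ := h.tendsto_integral_inv_mul hxI (c := c) (cs := fun _ => c)
      (H := fun n t => lipReg f n (v n t)) (H' := fun t => f (V t))
      (fun n => ((lipschitzWith_lipReg h.f_lower n).continuous.comp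
        (hvc n)).aestronglyMeasurable)
      (by
        filter_upwards [eventually_ge_atTop N] with n hn t ht
        have h3 : 0 < κ * t := mul_pos hκ ht.1
        have h4 := hlow n hn t ht
        have h5 := lipReg_le_self h.f_lower n (h3.trans_le h4)
        have h6 := lower_le_lipReg h.f_lower n (v n t)
        have h7 : f (v n t) ≤ f (κ * t) := h.f_anti h3 (h3.trans_le h4) h4
        rw [abs_le]
        constructor
        · linarith [neg_abs_le m, abs_nonneg (f (κ * t))]
        · linarith [le_abs_self (f (κ * t)), abs_nonneg m])
      hBi
      (by
        intro t ht
        have htI : t ∈ Ioo 0 L := ⟨ht.1, ht.2.trans hx.2⟩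
        have htI' := Ioo_subset_Icc_self htI
        have hVt := hVpos t htI
        have h3 : Tendsto (fun n => f (v n t)) atTop (𝓝 (f (V t))) :=
          (h.f_cont.continuousAt (Ioi_mem_nhds hVt)).tendsto.comp (hVlim t htI')
        -- Squeeze between `lipReg f n (V t)` and `f (v n t)`, both tending to `f (V t)`.
        refine tendsto_of_tendsto_of_tendsto_of_le_of_le' (tendsto_lipReg h.f_lower h.f_cont hVt)
          h3 (Eventually.of_forall fun n =>
            lipReg_antitone h.f_lower h.f_anti n (hvV n t htI')) ?_
        filter_upwards [(hVlim t htI').eventually (lt_mem_nhds hVt)] with n hn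
        exact lipReg_le_self h.f_lower n hn)
      tendsto_const_nhds
    refine ⟨h1, tendsto_nhds_unique (hVlim x hxI) ?_⟩
    refine h2.congr fun n => ?_
    rw [hv n x hxI]
  have hVint : ∀ p ∈ Ioo 0 L, ∀ q ∈ Ioo 0 L, p ≤ q →
      IntervalIntegrable (slopeField a g f c V) volume p q ∧
      V q = V p + ∫ t in p..q, slopeField a g f c V t := by
    intro p hp q hq hpq
    have h1 := (hlimit p hp).1
    have h2 := (hlimit q hq).1
    refine ⟨h1.symm.trans h2, ?_⟩
    rw [(hlimit q hq).2, (hlimit p hp).2, intervalIntegral.integral_add_adjacent_intervals h1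
      (h1.symm.trans h2)]
  have hVcont : ContinuousOn V (Ioo 0 L) := by
    intro x hx
    set y := (x + L) / 2 with hy
    have hyI : y ∈ Ioo 0 L := ⟨by linarith [hx.1], by linarith [hx.2]⟩
    have hxy : x < y := by linarith [hx.2]
    have h1 : ContinuousOn V (Ioo 0 y) := by
      refine ((continuousOn_primitive_Icc hyI.1.le (hlimit y hyI).1).mono
        Ioo_subset_Icc_self).congr fun z hz => ?_
      exact (hlimit z ⟨hz.1, hz.2.trans hyI.2⟩).2
    exact (h1.continuousAt (Ioo_mem_nhds hx.1 hxy)).continuousWithinAt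
  obtain ⟨R, hR⟩ := isCompact_Icc.exists_bound_of_continuousOn (hv₀.continuousOn h)
  have hw := h.memLp_slopeField_of_interior hVcont hVpos (fun x hx =>
    (hV₀ x (Ioo_subset_Icc_self hx)).trans
      ((le_abs_self _).trans (hR x (Ioo_subset_Icc_self hx)))) hVint
  have hwi := hw.intervalIntegrable_two hL.le
  -- The equation for `V` is known only inside `(0, L)`. `W` is its continuous extension to `[0,
  -- L]`, and `0 < V ≤ v₀` forces `W L = 0`.
  set W : ℝ → ℝ := fun x => ∫ t in (0 : ℝ)..x, slopeField a g f c V t with hW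
  have hWV : ∀ x ∈ Ioo 0 L, W x = V x := fun x hx => (hlimit x hx).2.symm
  have hWc : ContinuousOn W (Icc 0 L) := continuousOn_primitive_Icc hL.le hwi
  have hfV : MemLp (fun x => f (V x)) 2 (intervalMeasure L) := by
    have h1 : MemLp (fun x => a x * slopeField a g f c V x - (g x + c)) 2 (intervalMeasure L) := by
      refine (memLp_bdd_mul (C := β) h.ha ?_ hw).sub (h.memLp_datum c)
      filter_upwards [h.hab] with x hx
      rw [abs_of_pos (h.hα.trans_le hx.1)]
      exact hx.2
    refine (memLp_congr_ae ?_).mp h1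
    filter_upwards [h.hab] with x hx
    rw [mul_slopeField (h.hα.trans_le hx.1).ne']
    ring
  refine ⟨W, fun x hx => (hWV x hx).symm ▸ hVpos x hx, ?_, fun x hx => ?_, ?_⟩
  · refine (memLp_congr_ae ?_).mp hfV
    filter_upwards [ae_restrict_mem measurableSet_Ioo] with x hx
    rw [hWV x hx]
  · refine intervalIntegral_congr_ae_intervalMeasure ?_ h0 hx
    filter_upwards [ae_restrict_mem measurableSet_Ioo] with t ht
    simp only [slopeField]
    rw [hWV t ht]
  · have hLI := right_mem_Icc.mpr hL.le
    have hcl : L ∈ closure (Ioo 0 L) := by rw [closure_Ioo hL.ne]; exact hLI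
    refine le_antisymm ?_ ?_
    · have h1 : W L ≤ v₀ L := by
        have := mem_closure_iff_nhdsWithin_neBot.mp hcl
        refine le_of_tendsto_of_tendsto ((hWc L hLI).mono Ioo_subset_Icc_self)
          ((hv₀.continuousOn h L hLI).mono Ioo_subset_Icc_self)
          (eventually_nhdsWithin_of_forall fun x hx => ?_)
        rw [hWV x hx]
        exact hV₀ x (Ioo_subset_Icc_self hx)
      rwa [hv₀.right] at h1
    · have := mem_closure_iff_nhdsWithin_neBot.mp hcl
      refine ge_of_tendsto ((hWc L hLI).mono Ioo_subset_Icc_self)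
        (eventually_nhdsWithin_of_forall fun x hx => ?_)
      rw [hWV x hx]
      exact (hVpos x hx).le

/-- The set of the integration constants of profiles is closed under increasing limits. -/
theorem exists_profile_of_tendsto (h : IsAdmissible L α β m a g f) {cs : ℕ → ℝ} {v : ℕ → ℝ → ℝ}
    (hv : ∀ n, IsProfile L a g f (cs n) (v n)) (hcs : Monotone cs)
    (hc : Tendsto cs atTop (𝓝 c)) : ∃ V, IsProfile L a g f c V := by
  have hL := h.hL
  have hα := h.hα
  have hcle : ∀ n, cs n ≤ c := hcs.ge_of_tendsto hc
  have hmono : ∀ x ∈ Icc 0 L, Monotone fun n => v n x := fun x hx n k hnk =>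
    (hv n).le_of_le (hv k) h (hcs hnk) x hx
  have hbdd : ∀ x ∈ Icc 0 L, BddAbove (range fun n => v n x) := by
    intro x hx
    refine ⟨v 0 x + (c - cs 0) / α * x, ?_⟩
    rintro _ ⟨n, rfl⟩
    have h1 := (hv 0).sub_le (hv n) h (hcs (Nat.zero_le n)) x hx
    have h2 : (cs n - cs 0) / α * x ≤ (c - cs 0) / α * x :=
      mul_le_mul_of_nonneg_right
        (div_le_div_of_nonneg_right (by linarith [hcle n]) hα.le) hx.1
    simp only
    linarith
  set V : ℝ → ℝ := fun x => ⨆ n, v n x with hV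
  have hVlim : ∀ x ∈ Icc 0 L, Tendsto (fun n => v n x) atTop (𝓝 (V x)) := fun x hx =>
    tendsto_atTop_ciSup (hmono x hx) (hbdd x hx)
  have hvV : ∀ n, ∀ x ∈ Icc 0 L, v n x ≤ V x := fun n x hx => le_ciSup (hbdd x hx) n
  have hVpos : ∀ x ∈ Ioo 0 L, 0 < V x := fun x hx =>
    ((hv 0).pos x hx).trans_le (hvV 0 x (Ioo_subset_Icc_self hx))
  have hflim : ∀ x ∈ Ioo 0 L, Tendsto (fun n => f (v n x)) atTop (𝓝 (f (V x))) := fun x hx =>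
    (h.f_cont.continuousAt (Ioi_mem_nhds (hVpos x hx))).tendsto.comp
      (hVlim x (Ioo_subset_Icc_self hx))
  -- The lowest profile `v 0` dominates all the others through `f`, and `f (v 0 x)` is square
  -- integrable up to both endpoints, so no barrier is needed here.
  have hbound : ∀ x ∈ Ioo 0 L, ∀ s ≥ v 0 x, |f s| ≤ |f (v 0 x)| + |m| := by
    intro x hx s hs
    have h0 := (hv 0).pos x hx
    have h1 : f s ≤ f (v 0 x) := h.f_anti h0 (h0.trans_le hs) hs
    have h2 := h.f_lower s (h0.trans_le hs)
    rw [abs_le]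
    constructor
    · linarith [neg_abs_le m, abs_nonneg (f (v 0 x))]
    · linarith [le_abs_self (f (v 0 x)), abs_nonneg m]
  have hBL : MemLp (fun x => |f (v 0 x)| + |m|) 2 (intervalMeasure L) :=
    (hv 0).memLp.abs.add (memLp_const _)
  refine ⟨V, hVpos, ?_, fun x hx => ?_, ?_⟩
  · refine hBL.mono' (aestronglyMeasurable_of_tendsto_ae atTop (fun n => (hv n).memLp.1) ?_) ?_
    · filter_upwards [ae_restrict_mem measurableSet_Ioo] with x hx using hflim x hx
    · filter_upwards [ae_restrict_mem measurableSet_Ioo] with x hx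
      exact hbound x hx _ (hvV 0 x (Ioo_subset_Icc_self hx))
  · have hsub : Ioo 0 x ⊆ Ioo 0 L := Ioo_subset_Ioo_right hx.2
    have h2 := (h.tendsto_integral_inv_mul hx (c := c) (cs := cs)
      (H := fun n t => f (v n t)) (H' := fun t => f (V t)) (fun n => (hv n).memLp.1)
      (Eventually.of_forall fun n t ht => hbound t (hsub ht) _
        (hmono t (Ioo_subset_Icc_self (hsub ht)) (Nat.zero_le n)))
      ((hBL.intervalIntegrable_two hL.le).mono_Icc (left_mem_Icc.mpr hL.le) hx)
      (fun t ht => hflim t (hsub ht)) hc).2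
    refine tendsto_nhds_unique (hVlim x hx) (h2.congr fun n => ?_)
    exact ((hv n).eq_integral x hx).symm
  · simp [hV, (hv _).right]

end IsAdmissible

/-! ### Weak solutions and profiles -/

section Nonlinearity

variable {L α β m c : ℝ} {a g : ℝ → ℝ} {φ : ℝ → EReal}

theorem isAdmissible_toReal (hL : 0 < L) (ha : AEStronglyMeasurable a (intervalMeasure L))
    (hα : 0 < α) (hab : ∀ᵐ x ∂(intervalMeasure L), α ≤ a x ∧ a x ≤ β)
    (hg : MemLp g 2 (intervalMeasure L))
    (hg_below : ∀ η ∈ Ioo 0 L, ∃ M : ℝ, 0 < M ∧ ∀ᵐ x ∂(volume.restrict (Icc 0 (L - η))), -M ≤ g x)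
    (hφ_cont : Continuous φ) (hφ_bot : ∀ s, φ s ≠ ⊥) (hφ_fin : ∀ s, s ≠ 0 → φ s < ⊤)
    (hφ_zero : φ 0 = ⊤) (hφ_int : IntegrableOn (fun t => (φ t).toReal) (Ioo 0 (1 / 2)))
    (hφ_anti : ∀ s t : ℝ, 0 ≤ s → s ≤ t → φ t ≤ φ s) (hm : ∀ s > 0, m ≤ (φ s).toReal) :
    IsAdmissible L α β m a g (fun s => (φ s).toReal) := by
  have hfin : ∀ s > 0, φ s ≠ ⊤ := fun s hs => (hφ_fin s (ne_of_gt hs)).ne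
  have hcont : ContinuousOn (fun s => (φ s).toReal) (Ioi 0) :=
    EReal.continuousOn_toReal.comp hφ_cont.continuousOn fun s hs => by
      simp [hφ_bot s, hfin s hs]
  refine ⟨hL, hα, ha, hab, hg, hg_below, hcont, fun s hs t ht hst => ?_, hm, ?_, fun R => ?_⟩
  · exact EReal.toReal_le_toReal (hφ_anti s t (le_of_lt hs) hst) (hφ_bot t) (hfin s hs)
  · rw [tendsto_atTop]
    intro K
    have h1 : ∀ᶠ s in 𝓝[>] (0 : ℝ), (K : EReal) < φ s :=
      (hφ_cont.continuousAt.mono_left nhdsWithin_le_nhds).eventually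
        (lt_mem_nhds (by rw [hφ_zero]; exact EReal.coe_lt_top K))
    filter_upwards [h1, self_mem_nhdsWithin] with s hs hs0
    rw [← EReal.coe_toReal (hfin s hs0) (hφ_bot s), EReal.coe_lt_coe_iff] at hs
    exact hs.le
  · refine (hφ_int.union (t := Icc (1 / 4) R) ?_).mono_set fun x hx => ?_
    · exact (hcont.mono fun x hx => lt_of_lt_of_le (by norm_num) hx.1).integrableOn_Icc
    · rcases lt_or_ge x (1 / 2) with h | h
      · exact Or.inl ⟨hx.1, h⟩
      · exact Or.inr ⟨by linarith, hx.2.le⟩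

theorem IsProfile.isWeakSolution (h : IsAdmissible L α β m a g (fun s => (φ s).toReal))
    (hφ_bot : ∀ s, φ s ≠ ⊥) (hφ_fin : ∀ s, s ≠ 0 → φ s < ⊤) {v : ℝ → ℝ}
    (hv : IsProfile L a g (fun s => (φ s).toReal) c v) :
    ∃ u : SobolevZero L, IsWeakSolution L a g φ u ∧
      IsProfile L a g (fun s => (φ s).toReal) c u := by
  have hL := h.hL
  obtain ⟨u, hu, huv⟩ := SobolevZero.exists_weakDeriv_ae_eq hL (h.memLp_slopeField hv.memLp)
    (hv.integral_slopeField h)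
  have huv' : ∀ x ∈ Icc 0 L, u x = v x := fun x hx => (huv x hx).trans (hv.eq_integral x hx).symm
  have hslope : slopeField a g (fun s => (φ s).toReal) c v
      =ᵐ[intervalMeasure L] slopeField a g (fun s => (φ s).toReal) c u := by
    filter_upwards [ae_restrict_mem measurableSet_Ioo] with x hx
    simp only [slopeField, huv' x (Ioo_subset_Icc_self hx)]
  have hpos : ∀ x ∈ Ioo 0 L, 0 < u x := fun x hx => by
    rw [huv' x (Ioo_subset_Icc_self hx)]
    exact hv.pos x hx
  have hLp : MemLp (fun x => (φ (u x)).toReal) 2 (intervalMeasure L) := by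
    refine (memLp_congr_ae ?_).mp hv.memLp
    filter_upwards [ae_restrict_mem measurableSet_Ioo] with x hx
    simp only [huv' x (Ioo_subset_Icc_self hx)]
  refine ⟨u, isWeakSolution_of_ae_eq hL h.hg ?_ hLp (c := c) ?_, hpos, hLp, fun x hx => ?_, ?_⟩
  · filter_upwards [ae_restrict_mem measurableSet_Ioo] with x hx
    exact ⟨(hφ_fin _ (hpos x hx).ne').ne, hφ_bot _⟩
  · filter_upwards [hu, hslope, h.hab] with x h1 h2 h3
    rw [h1, h2, mul_slopeField (h.hα.trans_le h3.1).ne']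
    ring
  · rw [huv x hx]
    exact intervalIntegral_congr_ae_intervalMeasure hslope (left_mem_Icc.mpr hL.le) hx
  · exact u.apply_eq_zero (by simp)

/-- Weak solutions are positive, and they are profiles. -/
theorem IsWeakSolution.isProfile (h : IsAdmissible L α β m a g (fun s => (φ s).toReal))
    (hφ_cont : Continuous φ) (hφ_zero : φ 0 = ⊤) {u : SobolevZero L}
    (hu : IsWeakSolution L a g φ u) :
    ∃ c, IsProfile L a g (fun s => (φ s).toReal) c u := by
  have hL := h.hL
  have hβ := inv_pos.mpr h.hβ_pos
  have h0 := left_mem_Icc.mpr hL.le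
  obtain ⟨c, hc⟩ := hu.exists_const (C := β) hL h.ha (by
    filter_upwards [h.hab] with x hx
    rw [abs_of_pos (h.hα.trans_le hx.1)]
    exact hx.2) h.hg
  set w := slopeField a g (fun s => (φ s).toReal) c u with hw
  have hder : u.weakDeriv =ᵐ[intervalMeasure L] w := by
    filter_upwards [hc, h.hab] with x h1 h2
    have ha0 := (h.hα.trans_le h2.1).ne'
    rw [hw, slopeField, ← add_assoc, ← h1, ← mul_assoc, inv_mul_cancel₀ ha0, one_mul]
  have hwi : IntervalIntegrable w volume 0 L := h.intervalIntegrable_slopeField hu.memLp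
  have heq : ∀ x ∈ Icc 0 L, u x = ∫ t in (0 : ℝ)..x, w t := fun x hx =>
    (u.eq_integral hL hx).trans (intervalIntegral_congr_ae_intervalMeasure hder h0 hx)
  have hsub : ∀ x ∈ Icc 0 L, ∀ y ∈ Icc 0 L, u y - u x = ∫ t in x..y, w t := by
    intro x hx y hy
    rw [heq x hx, heq y hy]
    exact intervalIntegral.integral_interval_sub_left (hwi.mono_Icc h0 hy) (hwi.mono_Icc h0 hx)
  -- Near a zero `p < L`, `φ (u x)` exceeds `M + |c| + 1` while `g ≥ -M`, so `u` increases at rate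
  -- at least `β⁻¹`. The choice `η = (L - p) / 2` leaves room to the right of `p`.
  have hlocal : ∀ p ∈ Ico 0 L, u p = 0 → ∃ ε > 0, ∀ x ∈ Icc 0 L, ∀ y ∈ Icc 0 L, p - ε ≤ x →
      x ≤ y → y ≤ p + ε → β⁻¹ * (y - x) ≤ u y - u x := by
    intro p hp hup
    obtain ⟨M, -, hM⟩ := h.hg_below ((L - p) / 2)
      ⟨by linarith [hp.2], by linarith [hp.1]⟩
    rw [ae_restrict_iff' measurableSet_Icc] at hM
    have hev : ∀ᶠ x in 𝓝 p, ((M + |c| + 1 : ℝ) : EReal) < φ (u x) := by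
      have h1 : ContinuousAt (fun x => φ (u x)) p :=
        (hφ_cont.comp u.continuous_apply).continuousAt
      refine h1.eventually (lt_mem_nhds ?_)
      simp only [hup, hφ_zero]
      exact EReal.coe_lt_top _
    obtain ⟨ε, hε, hball⟩ := Metric.eventually_nhds_iff.mp hev
    refine ⟨min (ε / 2) ((L - p) / 2), lt_min (by linarith) (by linarith [hp.2]), ?_⟩
    intro x hx y hy hpx hxy hyp
    rw [hsub x hx y hy]
    refine mul_le_integral_of_ae_le hxy (hwi.mono_Icc hx hy) ?_
    have hε1 : min (ε / 2) ((L - p) / 2) ≤ ε / 2 := min_le_left _ _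
    have hε2 : min (ε / 2) ((L - p) / 2) ≤ (L - p) / 2 := min_le_right _ _
    filter_upwards [ae_imp_of_ae_intervalMeasure h.ae_inv,
      ae_imp_of_ae_intervalMeasure hu.finite_ae, hM] with t hat hft hgt htI
    have htI' : t ∈ Icc 0 L := ⟨hx.1.trans htI.1, htI.2.trans hy.2⟩
    have h1 := hat htI'
    have h2 := hgt ⟨htI'.1, by linarith [htI.2]⟩
    have h3 : ((M + |c| + 1 : ℝ) : EReal) < φ (u t) := hball (by
      rw [Real.dist_eq, abs_lt]
      constructor <;> linarith [htI.1, htI.2])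
    rw [← EReal.coe_toReal (hft htI').1 (hft htI').2, EReal.coe_lt_coe_iff] at h3
    rw [hw, slopeField, ← mul_one β⁻¹]
    refine mul_le_mul h1.1 ?_ zero_le_one (hβ.le.trans h1.1)
    linarith [neg_abs_le c]
  have hnonneg : ∀ x ∈ Icc 0 L, 0 ≤ u x := by
    intro x hx
    by_contra hneg
    rw [not_le] at hneg
    -- `u` would be negative just after its last zero `p`, where it has to increase.
    obtain ⟨p, hp, hp0, hpn⟩ := exists_last_zero hx.1 u.continuous_apply.continuousOn
      (u.apply_eq_zero (x := 0) (by simp)).ge hneg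
    have hpL : p < L := hp.2.trans_le hx.2
    obtain ⟨ε, hε, hinc⟩ := hlocal p ⟨hp.1, hpL⟩ hp0
    have hpy : p < min x (p + ε) := lt_min hp.2 (by linarith)
    have h1 := hinc p ⟨hp.1, hpL.le⟩ (min x (p + ε))
      ⟨hp.1.trans hpy.le, (min_le_left _ _).trans hx.2⟩ (by linarith) hpy.le (min_le_right _ _)
    have h2 := hpn _ ⟨hpy, min_le_left _ _⟩
    have h3 : 0 < β⁻¹ * (min x (p + ε) - p) := mul_pos hβ (sub_pos.mpr hpy)
    linarith
  have hpos : ∀ x ∈ Ioo 0 L, 0 < u x := by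
    intro p hp
    refine lt_of_le_of_ne (hnonneg p (Ioo_subset_Icc_self hp)) fun hp0 => ?_
    -- An interior zero would make `u` negative just before it.
    obtain ⟨ε, hε, hinc⟩ := hlocal p ⟨hp.1.le, hp.2⟩ hp0.symm
    have hpy : max 0 (p - ε) < p := max_lt hp.1 (by linarith)
    have hyI : max 0 (p - ε) ∈ Icc 0 L := ⟨le_max_left _ _, hpy.le.trans hp.2.le⟩
    have h1 := hinc _ hyI p (Ioo_subset_Icc_self hp) (le_max_right _ _) hpy.le (by linarith)
    have h2 := hnonneg _ hyI
    have h3 : 0 < β⁻¹ * (p - max 0 (p - ε)) := mul_pos hβ (sub_pos.mpr hpy)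
    linarith
  exact ⟨c, hpos, hu.memLp, heq, u.apply_eq_zero (by simp)⟩

end Nonlinearity

/-! ### Norm bounds, smallness for very negative constants, and continuity in the constant. -/

theorem SobolevZero.norm_sq_eq {L : ℝ} (u : SobolevZero L) : ‖u‖ ^ 2 = ∫ x in Ioo 0 L, u.weakDeriv x ^ 2 := by
  rw [SobolevZero.norm_eq, Lp.norm_def, (Lp.memLp u.weakDeriv).toReal_eLpNorm_two_sq]

namespace IsProfile

variable {L α β m c : ℝ} {a g f : ℝ → ℝ}

theorem weakDeriv_ae_eq (h : IsAdmissible L α β m a g f) {u : SobolevZero L}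
    (hu : IsProfile L a g f c u) : u.weakDeriv =ᵐ[intervalMeasure L] slopeField a g f c u := by
  have hL := h.hL
  have h0 := left_mem_Icc.mpr hL.le
  have i1 := u.intervalIntegrable_weakDeriv hL.le
  have i2 := h.intervalIntegrable_slopeField hu.memLp (c := c)
  have := ae_eq_zero_of_forall_integral_eq_zero hL.le (i1.sub i2) fun x hx => by
    rw [intervalIntegral.integral_sub (i1.mono_Icc h0 hx) (i2.mono_Icc h0 hx),
      ← u.eq_integral hL hx, ← hu.eq_integral x hx, sub_self]
  filter_upwards [this] with x hx using sub_eq_zero.mp hx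

theorem norm_sq_le (h : IsAdmissible L α β m a g f) {u : SobolevZero L}
    (hu : IsProfile L a g f c u) : ‖u‖ ^ 2 ≤ (∫ x in Ioo 0 L, g x ^ 2) / α ^ 2 := by
  rw [SobolevZero.norm_sq_eq]
  refine le_of_eq_of_le (integral_congr_ae ?_) (hu.integral_slopeField_sq_le h)
  filter_upwards [hu.weakDeriv_ae_eq h] with x hx
  rw [hx]

/-- Profiles with integration constant close to `-∞` are uniformly small. -/
theorem exists_forall_lt (h : IsAdmissible L α β m a g f) {δ : ℝ} (hδ : 0 < δ) :
    ∃ C : ℝ, ∀ c ≤ C, ∀ v, IsProfile L a g f c v → ∀ x ∈ Icc 0 L, v x < δ := by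
  have hα := h.hα
  have hβ := h.hβ_pos
  set Γ : ℝ := ∫ x in Ioo 0 L, g x ^ 2 with hΓ
  have hΓ0 : 0 ≤ Γ := integral_nonneg fun x => sq_nonneg _
  -- Above height `δ / 2` one has `f (v t) + c ≤ -K`, so only `g` can push `v` up. By Young, its
  -- gain on `[p, x]` is at most `δ / 4 + (x - p) * Γ / (α ^ 2 * δ)`, and `K` is chosen so that the
  -- loss cancels the last term. Climbing from `δ / 2` to `δ` would need a net gain of `δ / 2`.
  set K : ℝ := β * (Γ / (α ^ 2 * δ)) with hK
  have hK0 : 0 ≤ K := by positivity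
  refine ⟨-f (δ / 2) - K, fun c hc v hv x hx => ?_⟩
  by_contra hlt
  rw [not_lt] at hlt
  obtain ⟨p, hp, hp0, hpn⟩ := exists_last_zero (F := fun y => δ / 2 - v y) hx.1
    (continuousOn_const.sub ((hv.continuousOn h).mono (Icc_subset_Icc_right hx.2)))
    (by simp only [hv.left h]; linarith) (by linarith)
  have hpI : p ∈ Icc 0 L := ⟨hp.1, hp.2.le.trans hx.2⟩
  have hinc := hv.sub_eq_integral h hpI hx
  have i1 : IntervalIntegrable (fun t => α⁻¹ * |g t| - K / β) volume p x :=
    ((((h.hg.intervalIntegrable_two h.hL.le).mono_Icc hpI hx).abs).const_mul _).sub (by simp)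
  have hle : ∫ t in p..x, slopeField a g f c v t ≤ ∫ t in p..x, (α⁻¹ * |g t| - K / β) := by
    refine intervalIntegral.integral_mono_ae_restrict hp.2.le
      ((h.intervalIntegrable_slopeField hv.memLp).mono_Icc hpI hx) i1 ?_
    rw [EventuallyLE, ← restrict_Ioo_eq_restrict_Icc, ae_restrict_iff' measurableSet_Ioo]
    filter_upwards [ae_imp_of_ae_intervalMeasure h.ae_inv] with t hat htI
    have h1 := hat ⟨hp.1.trans htI.1.le, htI.2.le.trans hx.2⟩
    have h2 := hpn t ⟨htI.1, htI.2.le⟩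
    have h3 : f (v t) ≤ f (δ / 2) :=
      h.f_anti (by simp only [mem_Ioi]; linarith) (by simp only [mem_Ioi]; linarith) (by linarith)
    have h4 : 0 < (a t)⁻¹ := (inv_pos.mpr hβ).trans_le h1.1
    calc slopeField a g f c v t ≤ (a t)⁻¹ * (|g t| - K) := by
          refine mul_le_mul_of_nonneg_left ?_ h4.le
          linarith [le_abs_self (g t)]
      _ = (a t)⁻¹ * |g t| - (a t)⁻¹ * K := mul_sub _ _ _
      _ ≤ α⁻¹ * |g t| - β⁻¹ * K :=
          sub_le_sub (mul_le_mul_of_nonneg_right h1.2 (abs_nonneg _))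
            (mul_le_mul_of_nonneg_right h1.1 hK0)
      _ = α⁻¹ * |g t| - K / β := by rw [inv_mul_eq_div β]
  rw [intervalIntegral.integral_sub
    ((((h.hg.intervalIntegrable_two h.hL.le).mono_Icc hpI hx).abs).const_mul _) (by simp),
    intervalIntegral.integral_const_mul, intervalIntegral.integral_const, smul_eq_mul] at hle
  have hcs := integral_abs_sq_le hpI hx hp.2.le h.hg
  set I := ∫ t in p..x, |g t| with hI
  have hKβ : K / β = Γ / (α ^ 2 * δ) := by rw [hK]; field_simp
  rw [hKβ] at hle
  have hyoung : α⁻¹ * I ≤ δ / 4 + I ^ 2 / (α ^ 2 * δ) := by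
    have h1 : 0 ≤ (δ / 2 - α⁻¹ * I) ^ 2 / δ := by positivity
    have h2 : (δ / 2 - α⁻¹ * I) ^ 2 / δ = δ / 4 + I ^ 2 / (α ^ 2 * δ) - α⁻¹ * I := by
      field_simp
      ring
    linarith
  have h5 : I ^ 2 / (α ^ 2 * δ) ≤ (x - p) * (Γ / (α ^ 2 * δ)) := by
    rw [mul_div_assoc']
    gcongr
  linarith

/-- Continuous dependence of the solution on the integration constant. -/
theorem tendsto_of_tendsto (h : IsAdmissible L α β m a g f) {ι : Type*} {l : Filter ι}
    [l.IsCountablyGenerated] {us : ι → SobolevZero L} {u : SobolevZero L} {cs : ι → ℝ} {c' : ℝ}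
    {v : ℝ → ℝ} (hus : ∀ i, IsProfile L a g f (cs i) (us i)) (hu : IsProfile L a g f c u)
    (hv : IsProfile L a g f c' v) (hc' : c' < c) (hcs : Tendsto cs l (𝓝 c)) :
    Tendsto us l (𝓝 u) := by
  have hα := h.hα
  have hpt : ∀ x ∈ Ioo 0 L, Tendsto (fun i => us i x) l (𝓝 (u x)) := by
    intro x hx
    have hxI := Ioo_subset_Icc_self hx
    rw [tendsto_iff_norm_sub_tendsto_zero]
    have hlim : Tendsto (fun i => |cs i - c| / α * x) l (𝓝 0) := by
      have h1 : Tendsto (fun i => |cs i - c|) l (𝓝 0) := by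
        simpa [Real.norm_eq_abs] using tendsto_iff_norm_sub_tendsto_zero.mp hcs
      simpa using (h1.div_const α).mul_const x
    refine squeeze_zero (fun _ => norm_nonneg _) (fun i => ?_) hlim
    rw [Real.norm_eq_abs]
    rcases le_total (cs i) c with hi | hi
    · have h1 := (hus i).le_of_le hu h hi x hxI
      have h2 := (hus i).sub_le hu h hi x hxI
      rw [abs_sub_comm, abs_of_nonneg (sub_nonneg.mpr h1), abs_sub_comm,
        abs_of_nonneg (sub_nonneg.mpr hi)]
      exact h2
    · have h1 := hu.le_of_le (hus i) h hi x hxI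
      have h2 := hu.sub_le (hus i) h hi x hxI
      rw [abs_of_nonneg (sub_nonneg.mpr h1), abs_of_nonneg (sub_nonneg.mpr hi)]
      exact h2
  -- As `c' < c`, the profile `v` eventually lies below every `us i`, and `f (v x)` supplies the
  -- square integrable bound.
  have hbound : ∀ x ∈ Ioo 0 L, ∀ s ≥ v x, |f s| ≤ |f (v x)| + |m| := by
    intro x hx s hs
    have h0 := hv.pos x hx
    have h1 : f s ≤ f (v x) := h.f_anti h0 (h0.trans_le hs) hs
    have h2 := h.f_lower s (h0.trans_le hs)
    rw [abs_le]
    constructor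
    · linarith [neg_abs_le m, abs_nonneg (f (v x))]
    · linarith [le_abs_self (f (v x)), abs_nonneg m]
  set bound : ℝ → ℝ := fun x => α⁻¹ * (2 * (|f (v x)| + |m|) + 1) with hbd
  have hboundL : MemLp bound 2 (intervalMeasure L) :=
    (((hv.memLp.abs.add (memLp_const |m|)).const_mul 2).add (memLp_const 1)).const_mul _
  have hsq : ∀ i, ‖us i - u‖ ^ 2 = ∫ x in Ioo 0 L,
      (slopeField a g f (cs i) (us i) x - slopeField a g f c u x) ^ 2 := by
    intro i
    rw [SobolevZero.norm_sq_eq, map_sub]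
    refine integral_congr_ae ?_
    filter_upwards [Lp.coeFn_sub (us i).weakDeriv u.weakDeriv, (hus i).weakDeriv_ae_eq h,
      hu.weakDeriv_ae_eq h] with x h1 h2 h3
    rw [h1, Pi.sub_apply, h2, h3]
  have hint : Tendsto (fun i => ∫ x in Ioo 0 L,
      (slopeField a g f (cs i) (us i) x - slopeField a g f c u x) ^ 2) l
      (𝓝 (∫ _ in Ioo 0 L, (0 : ℝ))) := by
    refine tendsto_integral_filter_of_dominated_convergence (fun x => bound x ^ 2)
      (Eventually.of_forall fun i => (((h.memLp_slopeField (hus i).memLp).sub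
        (h.memLp_slopeField hu.memLp)).1.pow 2)) ?_ hboundL.integrable_sq ?_
    · have hev1 : ∀ᶠ i in l, c' < cs i := hcs.eventually (lt_mem_nhds hc')
      have hev2 : ∀ᶠ i in l, |cs i - c| < 1 := by
        simpa [Real.dist_eq] using Metric.tendsto_nhds.mp hcs 1 one_pos
      filter_upwards [hev1, hev2] with i hi1 hi2
      filter_upwards [h.ae_abs_inv, ae_restrict_mem measurableSet_Ioo] with x hx hxI
      have hxI' := Ioo_subset_Icc_self hxI
      have h1 := hbound x hxI _ (hv.le_of_le (hus i) h hi1.le x hxI')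
      have h2 := hbound x hxI _ (hv.le_of_le hu h hc'.le x hxI')
      have h3 : |slopeField a g f (cs i) (us i) x - slopeField a g f c u x| ≤ bound x := by
        simp only [slopeField, hbd]
        rw [← mul_sub, abs_mul]
        refine mul_le_mul hx ?_ (abs_nonneg _) (inv_pos.mpr hα).le
        have h4 : f (us i x) + (g x + cs i) - (f (u x) + (g x + c)) =
            (f (us i x) - f (u x)) + (cs i - c) := by ring
        rw [h4]
        refine (abs_add_le _ _).trans (add_le_add ?_ hi2.le)
        refine (abs_sub _ _).trans ?_
        linarith
      rw [Real.norm_eq_abs, abs_pow]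
      exact pow_le_pow_left₀ (abs_nonneg _) h3 2
    · filter_upwards [ae_restrict_mem measurableSet_Ioo] with x hx
      have h1 : Tendsto (fun i => f (us i x)) l (𝓝 (f (u x))) :=
        (h.f_cont.continuousAt (Ioi_mem_nhds (hu.pos x hx))).tendsto.comp (hpt x hx)
      have h2 : Tendsto (fun i => slopeField a g f (cs i) (us i) x) l
          (𝓝 (slopeField a g f c u x)) := (h1.add (hcs.const_add _)).const_mul _
      simpa using (h2.sub_const (slopeField a g f c u x)).pow 2
  rw [integral_zero] at hint
  rw [tendsto_iff_norm_sub_tendsto_zero]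
  have h1 := (hint.congr fun i => (hsq i).symm).sqrt
  simpa [Real.sqrt_sq (norm_nonneg _)] using h1

end IsProfile

/-! ### Weak convergence in `H^1_0(0, L)` -/

namespace SobolevZero

variable {L : ℝ}

/-- The derivative as a linear isometry onto its range in `L^2(0, L)`. -/
noncomputable def weakDerivIsometry (L : ℝ) :
    SobolevZero L →ₗᵢ[ℝ] Lp ℝ 2 (intervalMeasure L) where
  toLinearMap := weakDeriv
  norm_map' _ := rfl

/-- Every continuous linear form on `H^1_0(0, L)` is the `L^2` product of the derivative with
some function. -/
theorem exists_inner_weakDeriv (y : SobolevZero L →L[ℝ] ℝ) :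
    ∃ η : Lp ℝ 2 (intervalMeasure L), ∀ u : SobolevZero L, y u = inner ℝ η u.weakDeriv := by
  let e := (weakDerivIsometry L).equivRange
  -- Hahn-Banach extends the form from the range of the derivative to `L^2`, where Riesz represents
  -- it; the range need not be known to be closed.
  obtain ⟨G, hG, -⟩ := exists_extension_norm_eq
    (LinearMap.range (weakDerivIsometry L).toLinearMap)
    (y.comp (e.symm.toContinuousLinearEquiv : _ →L[ℝ] SobolevZero L))
  refine ⟨(InnerProductSpace.toDual ℝ _).symm G, fun u => ?_⟩
  rw [InnerProductSpace.toDual_symm_apply]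
  have h1 := hG (e u)
  have h2 : ((e u : LinearMap.range (weakDerivIsometry L).toLinearMap) :
      Lp ℝ 2 (intervalMeasure L)) = u.weakDeriv := rfl
  rw [h2] at h1
  rw [h1]
  simp

/-- Pointwise convergence is thus convergence of the derivatives tested against indicators of `(0,
x)`, whose span is dense in `L^2`. -/
theorem inner_indicator_weakDeriv (hL : 0 < L) (u : SobolevZero L) {x : ℝ} (hx : x ∈ Icc 0 L) :
    inner ℝ (indicatorConstLp 2 (μ := intervalMeasure L) (measurableSet_Ioo (a := 0) (b := x))
      (measure_ne_top _ _) (1 : ℝ)) u.weakDeriv = u x := by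
  rw [L2.inner_indicatorConstLp_one, Measure.restrict_restrict measurableSet_Ioo,
    inter_eq_left.mpr (Ioo_subset_Ioo_right hx.2), u.eq_integral hL hx,
    intervalIntegral_eq_setIntegral_Ioo hx.1]

/-- A bounded family of `H^1_0(0, L)` which converges pointwise to `0` converges weakly to `0`. -/
theorem tendsto_weak_zero_of_bounded (hL : 0 < L) {ι : Type*} {l : Filter ι}
    {us : ι → SobolevZero L} {B : ℝ} (hB : ∀ i, ‖us i‖ ≤ B)
    (hpt : ∀ x ∈ Icc 0 L, Tendsto (fun i => us i x) l (𝓝 0)) :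
    Tendsto (fun i => toWeakSpace ℝ (SobolevZero L) (us i)) l
      (𝓝 (toWeakSpace ℝ (SobolevZero L) 0)) := by
  have hinj : Function.Injective (topDualPairing ℝ (SobolevZero L)).flip := by
    rw [injective_iff_map_eq_zero]
    intro x hx
    exact SeparatingDual.eq_zero_of_forall_dual_eq_zero (R := ℝ) fun y => LinearMap.congr_fun hx y
  refine (WeakBilin.tendsto_iff_forall_eval_tendsto (topDualPairing ℝ (SobolevZero L)).flip
    hinj).mpr fun y => ?_
  have hgoal : Tendsto (fun i => y (us i)) l (𝓝 (y 0)) := by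
    obtain ⟨η, hη⟩ := exists_inner_weakDeriv y
    rw [map_zero]
    simp only [hη]
    let S : Submodule ℝ (Lp ℝ 2 (intervalMeasure L)) :=
      { carrier := {ζ | Tendsto (fun i => inner ℝ ζ (us i).weakDeriv) l (𝓝 0)}
        zero_mem' := by simpa using tendsto_const_nhds
        add_mem' := fun {ζ ξ} hζ hξ => by
          simp only [mem_ofPred_eq, inner_add_left] at *
          simpa using hζ.add hξ
        smul_mem' := fun k ζ hζ => by
          simp only [mem_ofPred_eq, inner_smul_left] at *
          simpa using hζ.const_mul k }
    -- `S` contains the indicators of `(0, x)`; a function orthogonal to them has zero primitive,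
    -- hence is zero, so `S` is dense.
    have hclosure : η ∈ S.topologicalClosure := by
      have htop : S.topologicalClosure = ⊤ := by
        rw [Submodule.topologicalClosure_eq_top_iff, Submodule.eq_bot_iff]
        intro ζ hζ
        have hint : ∀ x ∈ Icc 0 L, ∫ t in (0 : ℝ)..x, ζ t = 0 := by
          intro x hx
          have hmem : indicatorConstLp 2 (μ := intervalMeasure L)
              (measurableSet_Ioo (a := 0) (b := x)) (measure_ne_top _ _) (1 : ℝ) ∈ S := by
            change Tendsto _ _ _
            simpa only [inner_indicator_weakDeriv hL _ hx] using hpt x hx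
          have h1 := (Submodule.mem_orthogonal _ _).mp hζ _ hmem
          rwa [L2.inner_indicatorConstLp_one, Measure.restrict_restrict measurableSet_Ioo,
            inter_eq_left.mpr (Ioo_subset_Ioo_right hx.2),
            ← intervalIntegral_eq_setIntegral_Ioo hx.1] at h1
        have h0 := ae_eq_zero_of_forall_integral_eq_zero hL.le
          ((Lp.memLp ζ).intervalIntegrable_two hL.le) hint
        exact (Lp.eq_zero_iff_ae_eq_zero).mpr h0
      rw [htop]
      exact Submodule.mem_top
    rw [Metric.tendsto_nhds]
    intro ε hε
    have hB1 : 0 < |B| + 1 := by positivity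
    -- The norm bound makes the error of replacing `η` by `ζ` uniform in `i`.
    obtain ⟨ζ, hζS, hζ⟩ := Metric.mem_closure_iff.mp hclosure (ε / (2 * (|B| + 1))) (by positivity)
    have hζS' : Tendsto (fun i => inner ℝ ζ (us i).weakDeriv) l (𝓝 0) := hζS
    filter_upwards [Metric.tendsto_nhds.mp hζS' (ε / 2) (by positivity)] with i hi
    rw [dist_zero_right, Real.norm_eq_abs] at hi ⊢
    have h1 : inner ℝ η (us i).weakDeriv =
        inner ℝ ζ (us i).weakDeriv + inner ℝ (η - ζ) (us i).weakDeriv := by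
      rw [inner_sub_left]
      ring
    have h2 : |inner ℝ (η - ζ) (us i).weakDeriv| ≤ ε / (2 * (|B| + 1)) * (|B| + 1) := by
      refine (abs_real_inner_le_norm _ _).trans (mul_le_mul ?_ ?_ (norm_nonneg _) (by positivity))
      · rw [← dist_eq_norm]
        exact hζ.le
      · rw [← norm_eq]
        linarith [hB i, le_abs_self B]
    have h3 : ε / (2 * (|B| + 1)) * (|B| + 1) = ε / 2 := by field_simp
    rw [h1]
    refine (abs_add_le _ _).trans_lt ?_
    linarith
  exact hgoal

end SobolevZero

/-! ### The main theorem. -/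

theorem mainTheorem2 (L α β : ℝ) (a g : ℝ → ℝ) (φ : ℝ → EReal)
    (hL : 0 < L)
    -- `a ∈ L^∞(0, L)` with `α ≤ a ≤ β`
    (ha : AEStronglyMeasurable a (intervalMeasure L))
    (hα : 0 < α) (hαβ : α < β)
    (hab : ∀ᵐ x ∂(intervalMeasure L), α ≤ a x ∧ a x ≤ β)
    -- `g ∈ L^2(0, L)`, bounded below on each `[0, L - η]`
    (hg : MemLp g 2 (intervalMeasure L))
    (hg_below : ∀ η ∈ Ioo 0 L, ∃ M : ℝ, 0 < M ∧ ∀ᵐ x ∂(volume.restrict (Icc 0 (L - η))), -M ≤ g x)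
    -- `φ : ℝ → ℝ ∪ {+∞}` is continuous, `φ(0) = +∞`, and `φ(s) < +∞` for `s ≠ 0`
    (hφ_cont : Continuous φ)
    (hφ_bot : ∀ s, φ s ≠ ⊥)
    (hφ_fin : ∀ s, s ≠ 0 → φ s < ⊤)
    (hφ_zero : φ 0 = ⊤)
    -- `φ` is integrable at `0`
    (hφ_int : ∀ δ : ℝ, 0 < δ → δ < 1 →
      IntegrableOn (fun t => (φ t).toReal) (Ioo 0 δ) ∧
      IntegrableOn (fun t => (φ t).toReal) (Ioo (-δ) 0))
    -- `φ` is bounded away from `0`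
    (hφ_bdd : ∀ δ : ℝ, 0 < δ → ∃ C : ℝ, ∀ s : ℝ, δ ≤ |s| → |(φ s).toReal| ≤ C)
    -- `φ` is non-increasing on `[0, +∞)`
    (hφ_anti : ∀ s t : ℝ, 0 ≤ s → s ≤ t → φ t ≤ φ s)
    -- there is at least one weak solution
    (hex : ∃ u : SobolevZero L, IsWeakSolution L a g φ u) :
    {u : SobolevZero L | IsWeakSolution L a g φ u}.Infinite ∧
    ∃ (cstar : ℝ) (U : Iic cstar → SobolevZero L),
      (cstar : EReal) ≤
        ((1 / √L * (β / α + 1) * (eLpNorm g 2 (intervalMeasure L)).toReal : ℝ) : EReal)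
          - ⨅ s, φ s ∧
      Continuous (fun c => toWeakSpace ℝ (SobolevZero L) (U c)) ∧
      (∀ c, IsWeakSolution L a g φ (U c)) ∧
      -- `c` is the integration constant of the solution `U(c)`
      (∀ c : Iic cstar, ∀ᵐ x ∂(intervalMeasure L),
        a x * (U c).weakDeriv x = (φ (U c x)).toReal + g x + c) ∧
      (∀ c, ∀ x ∈ Icc 0 L, 0 ≤ U c x) ∧
      (∀ c₁ c₂ : Iic cstar, c₁ < c₂ → ∀ x ∈ Ioo 0 L, U c₁ x < U c₂ x) ∧
      Tendsto (fun c => toWeakSpace ℝ (SobolevZero L) (U c)) atBot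
        (𝓝 (toWeakSpace ℝ (SobolevZero L) 0)) ∧
      TendstoUniformlyOn (fun c x => U c x) (fun _ => 0) atBot (Icc 0 L) ∧
      (∀ u : SobolevZero L, IsWeakSolution L a g φ u → ∃ c, u = U c) := by
  have hadm : ∀ m : ℝ, (∀ s > 0, m ≤ (φ s).toReal) →
      IsAdmissible L α β m a g (fun s => (φ s).toReal) := fun m hm =>
    isAdmissible_toReal hL ha hα hab hg hg_below hφ_cont hφ_bot hφ_fin hφ_zero
      (hφ_int (1 / 2) (by norm_num) (by norm_num)).1 hφ_anti hm
  set f : ℝ → ℝ := fun s => (φ s).toReal with hf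
  obtain ⟨m, hm⟩ : ∃ m : ℝ, ∀ s > 0, m ≤ f s := by
    obtain ⟨C, hC⟩ := hφ_bdd 1 one_pos
    refine ⟨-C, fun s hs => ?_⟩
    rcases le_total 1 s with h1 | h1
    · exact (abs_le.mp (hC s (h1.trans (le_abs_self s)))).1
    · refine (abs_le.mp (hC 1 (by simp))).1.trans ?_
      exact EReal.toReal_le_toReal (hφ_anti s 1 hs.le h1) (hφ_bot 1) (hφ_fin s hs.ne').ne
  have h := hadm m hm
  -- `S` is nonempty, bounded above, downward closed and contains its supremum: it is exactly `Iic
  -- cstar`.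
  set S : Set ℝ := {c | ∃ v, IsProfile L a g f c v} with hS
  obtain ⟨u₀, hu₀⟩ := hex
  obtain ⟨c₀, hc₀⟩ := hu₀.isProfile h hφ_cont hφ_zero
  have hne : S.Nonempty := ⟨c₀, _, hc₀⟩
  have hbdd : BddAbove S := ⟨_, fun c ⟨v, hv⟩ => hv.const_le h⟩
  obtain ⟨cs, hcs, hcl, hcS⟩ := exists_seq_tendsto_sSup hne hbdd
  choose vs hvs using hcS
  obtain ⟨V, hV⟩ := h.exists_profile_of_tendsto hvs hcs hcl
  set cstar := sSup S with hcstar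
  have hsol : ∀ c : Iic cstar, ∃ u : SobolevZero L, IsWeakSolution L a g φ u ∧
      IsProfile L a g f c u := fun c => by
    obtain ⟨v, hv⟩ := h.exists_profile_of_le hV c.2
    exact hv.isWeakSolution h hφ_bot hφ_fin
  choose U hUw hUp using hsol
  have hlt : ∀ c₁ c₂ : Iic cstar, c₁ < c₂ → ∀ x ∈ Ioo 0 L, U c₁ x < U c₂ x :=
    fun c₁ c₂ hc => (hUp c₁).lt_of_lt (hUp c₂) h hc
  have hinj : Function.Injective U := by
    intro c₁ c₂ heq
    have hmid : L / 2 ∈ Ioo 0 L := ⟨by linarith, by linarith⟩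
    rcases lt_trichotomy c₁ c₂ with hc | hc | hc
    · exact absurd (hlt c₁ c₂ hc _ hmid) (by rw [heq]; exact lt_irrefl _)
    · exact hc
    · exact absurd (hlt c₂ c₁ hc _ hmid) (by rw [heq]; exact lt_irrefl _)
  have hunif : ∀ δ > 0, ∀ᶠ c : Iic cstar in atBot, ∀ x ∈ Icc 0 L, U c x < δ := by
    intro δ hδ
    obtain ⟨C, hC⟩ := IsProfile.exists_forall_lt h hδ
    filter_upwards [eventually_le_atBot (⟨min C cstar, mem_Iic.mpr (min_le_right _ _)⟩ : Iic cstar)] with c hc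
    exact hC c (le_trans (Subtype.coe_le_coe.mpr hc) (min_le_left _ _)) _ (hUp c)
  refine ⟨?_, cstar, U, ?_, ?_, hUw, fun c => ?_, fun c => (hUp c).nonneg h, hlt, ?_, ?_,
    fun u hu => ?_⟩
  · have : Infinite (Iic cstar) := (Iic_infinite cstar).to_subtype
    exact (infinite_range_of_injective hinj).mono (range_subset_iff.mpr hUw)
  · rcases eq_or_ne (⨅ s, φ s) ⊥ with hbot | hbot
    · rw [hbot, EReal.sub_bot (EReal.coe_ne_bot _)]
      exact le_top
    · have htop : (⨅ s, φ s) ≠ ⊤ := ((iInf_le φ 1).trans_lt (hφ_fin 1 one_ne_zero)).ne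
      -- The bound on constants depends on the chosen lower bound of `f`, so it is applied again
      -- with the infimum of `φ` in place of the cruder `m`.
      set I : ℝ := (⨅ s, φ s).toReal with hI
      have hIφ : (⨅ s, φ s) = (I : EReal) := (EReal.coe_toReal htop hbot).symm
      have hIm : ∀ s > 0, I ≤ f s := fun s hs =>
        EReal.toReal_le_toReal (iInf_le φ s) hbot (hφ_fin s hs.ne').ne
      rw [hIφ, ← EReal.coe_sub, EReal.coe_le_coe_iff]
      exact hV.const_le (hadm I hIm)
  · refine (toWeakSpaceCLM ℝ (SobolevZero L)).continuous.comp ?_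
    rw [continuous_iff_continuousAt]
    intro c
    -- The half-line always has room below `c`, so the profile for `c - 1` can serve as dominating
    -- lower profile. Continuity holds even in norm.
    have hc' : (c : ℝ) - 1 ∈ Iic cstar := by
      have := c.2
      simp only [mem_Iic] at this ⊢
      linarith
    exact IsProfile.tendsto_of_tendsto h hUp (hUp c) (hUp ⟨_, hc'⟩) (sub_one_lt (c : ℝ))
      continuous_subtype_val.continuousAt
  · filter_upwards [(hUp c).weakDeriv_ae_eq h, hab] with x h1 h2
    rw [h1, mul_slopeField (hα.trans_le h2.1).ne']
    ring
  · refine SobolevZero.tendsto_weak_zero_of_bounded hL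
      (B := √((∫ x in Ioo 0 L, g x ^ 2) / α ^ 2))
      (fun c => Real.le_sqrt_of_sq_le ((hUp c).norm_sq_le h)) fun x hx => ?_
    rw [Metric.tendsto_nhds]
    intro δ hδ
    filter_upwards [hunif δ hδ] with c hc
    rw [dist_zero_right, Real.norm_eq_abs, abs_of_nonneg ((hUp c).nonneg h x hx)]
    exact hc x hx
  · rw [Metric.tendstoUniformlyOn_iff]
    intro δ hδ
    filter_upwards [hunif δ hδ] with c hc x hx
    rw [dist_zero_left, Real.norm_eq_abs, abs_of_nonneg ((hUp c).nonneg h x hx)]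
    exact hc x hx
  · obtain ⟨c, hc⟩ := hu.isProfile h hφ_cont hφ_zero
    have hcI : c ∈ Iic cstar := le_csSup hbdd ⟨_, hc⟩
    refine ⟨⟨c, hcI⟩, SobolevZero.ext_of_eqOn hL fun x hx => ?_⟩
    exact hc.eqOn (hUp ⟨c, hcI⟩) h (Ioo_subset_Icc_self hx)
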